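/- A virtual knot is an equivalence class of oriented Gauss codes (cyclic words in which every crossing label occurs once as an over-letter $O$ and once as an under-letter $U$, each crossing carrying a sign $\pm$) under renaming of crossings and the oriented Reidemeister moves; it is represented by diagrams in the plane with classical and virtual crossings. The first bridge number $b_1(K)$ is the minimal number of overbridges (strands from an undercrossing to the next undercrossing that contain at least one overcrossing; the crossingless diagram of the trivial knot counts as having one) over all Gauss codes of $K$. The second bridge number $b_2(K)$ is the minimal number of local maxima of the height function over all plane diagrams of $K$. Theorem. There exists a family of virtual knots $\{K_{m,n}\}_{m\ge 1,\,n\ge 0}$ such that for every $m\ge 1$ $$b_1(K_{m,n})=m\ \text{ for all } n\ge 0,\qquad\text{and}\qquad \lim_{n\to\infty}\bigl(b_2(K_{m,n})-b_1(K_{m,n})\bigr)=\infty .$$ Moreover $K_{m,n}$ can be taken to be the sum of $n$ copies of the four-crossing Kishino-type bow-tie knot, cut open to the word $O1^-\,O2^+\,U1^-\,O3^+\,O4^+\,U3^+\,U4^+\,U2^+$, and of the $m$-bridge classical knot that is the $(m-1)$-fold connected sum of trefoils, where each trefoil is cut open to the word $O1^+\,U2^+\,O3^+\,U1^+\,O2^+\,U3^+$;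 that is, $K_{m,n}$ is represented by the cyclic word obtained by writing these $n+(m-1)$ words, with disjoint sets of labels, one after the other. -/

import Mathlib

open Filter Topology

namespace VirtualBridge

/-! ### Oriented Gauss codes and virtual knots -/

/-- One letter of an oriented Gauss code: the passage through the crossing `label`, on the
over-strand (`isOver = true`, the letter `+label`) or on the under-strand (`isOver = false`, the letter
`-label`).  The flag `sign` is the sign of the crossing (`true` for a positive crossing, i.e. the
pair (direction of the over-strand, direction of the under-strand) is a positively oriented basis of
the plane); it records which of the two local orientation types the crossing has. -/
@[ext]
structure Letter where
  label : ℕ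
  isOver : Bool
  sign : Bool

/-- The same crossing, passed on the other strand. -/
def Letter.partner (e : Letter) : Letter := ⟨e.label, !e.isOver, e.sign⟩

/-- An (oriented) Gauss code: every label that occurs, occurs exactly once as an over-passage and
exactly once as an under-passage, with the same sign both times.  The list is read cyclically. -/
def IsGaussCode (w : List Letter) : Prop :=
  (w.map fun e => (e.label, e.isOver)).Nodup ∧ ∀ e ∈ w, e.partner ∈ w

/-- The type of oriented Gauss codes. -/
def GaussCode : Type := {w : List Letter // IsGaussCode w}

/-- The two letters `x`, `y` in this order if `b = true`, in the opposite order otherwise. -/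
def inOrder (b : Bool) (x y : Letter) : List Letter := if b then [x, y] else [y, x]

/-- Cyclic permutation, renaming of crossings, and the oriented Reidemeister moves on codes.
Since codes may be rotated, each move may be applied anywhere.

* `r1`: all four versions (`o`: over first or under first; `s`: sign of the new crossing).
* `r2`: two new crossings `a`, `b` of opposite signs; one strand passes over both consecutively,
  the other passes under both consecutively, in the same order (`d = true`) or in the opposite
  order (`d = false`).
* `r3`: a top, a middle and a bottom strand meet pairwise in the crossings `a` (top/middle),
  `b` (top/bottom), `c` (middle/bottom), with signs `x`, `y`, `z`; the move reverses the order of the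
  two passages on each of the three strands.  Three pairwise crossing directed lines with crossing
  signs `x`, `y`, `z` meet in the orders written on the left-hand side, or in the reversed orders.
  The three strands occur on the knot in the cyclic order top, middle, bottom (`r3`) or
  top, bottom, middle (`r3'`). -/
inductive Move : List Letter → List Letter → Prop
  | rotate (u v : List Letter) : Move (u ++ v) (v ++ u)
  | rename (σ : Equiv.Perm ℕ) (w : List Letter) :
      Move w (w.map fun e => ⟨σ e.label, e.isOver, e.sign⟩)
  | r1 (a : ℕ) (o s : Bool) (w : List Letter) : Move w (⟨a, o, s⟩ :: ⟨a, !o, s⟩ :: w)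
  | r2 (a b : ℕ) (s d : Bool) (u v : List Letter) :
      Move (u ++ v)
        ([⟨a, true, s⟩, ⟨b, true, !s⟩] ++ u ++
          inOrder d ⟨a, false, s⟩ ⟨b, false, !s⟩ ++ v)
  | r3 (a b c : ℕ) (x y z : Bool) (u v w : List Letter) :
      Move
        (inOrder (x == (y == z)) ⟨a, true, x⟩ ⟨b, true, y⟩ ++ u ++
          inOrder x ⟨a, false, x⟩ ⟨c, true, z⟩ ++ v ++
          inOrder y ⟨b, false, y⟩ ⟨c, false, z⟩ ++ w)
        (inOrder (!(x == (y == z))) ⟨a, true, x⟩ ⟨b, true, y⟩ ++ u ++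
          inOrder (!x) ⟨a, false, x⟩ ⟨c, true, z⟩ ++ v ++
          inOrder (!y) ⟨b, false, y⟩ ⟨c, false, z⟩ ++ w)
  | r3' (a b c : ℕ) (x y z : Bool) (u v w : List Letter) :
      Move
        (inOrder (x == (y == z)) ⟨a, true, x⟩ ⟨b, true, y⟩ ++ u ++
          inOrder y ⟨b, false, y⟩ ⟨c, false, z⟩ ++ v ++
          inOrder x ⟨a, false, x⟩ ⟨c, true, z⟩ ++ w)
        (inOrder (!(x == (y == z))) ⟨a, true, x⟩ ⟨b, true, y⟩ ++ u ++
          inOrder (!y) ⟨b, false, y⟩ ⟨c, false, z⟩ ++ v ++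
          inOrder (!x) ⟨a, false, x⟩ ⟨c, true, z⟩ ++ w)

/-- A virtual knot: a class of oriented Gauss codes under the equivalence relation generated by the
moves (`Quot` passes to the generated equivalence relation). -/
def VirtualKnot : Type := Quot fun g h : GaussCode => Move g.1 h.1

/-- The list `w` is an oriented Gauss code of the virtual knot `K`. -/
def VirtualKnot.IsRepresentedBy (K : VirtualKnot) (w : List Letter) : Prop :=
  ∃ h : IsGaussCode w, K = Quot.mk _ (⟨w, h⟩ : GaussCode)

/-! ### The first bridge number -/

/-- The number of overbridges of a code, i.e. of strands (from an under-letter to the next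
under-letter, cyclically) that contain an over-letter.  Such a strand is given by an under-letter
whose cyclic successor is an over-letter.  The crossingless diagram of the trivial knot, which is a
single closed arc, counts as having one bridge. -/
def overbridges (w : List Letter) : ℕ :=
  if w.isEmpty then 1 else (w.zip (w.rotate 1)).countP fun p => !p.1.isOver && p.2.isOver

/-- The first bridge number: the minimal number of overbridges of a Gauss code of `K`. -/
noncomputable def VirtualKnot.firstBridgeNumber (K : VirtualKnot) : ℕ :=
  sInf {k : ℕ | ∃ w, K.IsRepresentedBy w ∧ overbridges w = k}

/-! ### Diagrams in the plane and the second bridge number -/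

/-- The determinant of two plane vectors. -/
def det (v w : ℝ × ℝ) : ℝ := v.1 * w.2 - v.2 * w.1

/-- A virtual knot diagram: a generic closed oriented polygon in the plane with vertices
`pt 0, …, pt (n + 2)` (indices are cyclic, addition in `Fin (n + 3)` is modulo `n + 3`), in Morse
position with respect to the height function `(x, y) ↦ y`, all of whose crossings are either
classical, with over/under information, or virtual. -/
structure Diagram where
  n : ℕ
  pt : Fin (n + 3) → ℝ × ℝ
  /-- No edge is horizontal. -/
  height_ne : ∀ i, (pt i).2 ≠ (pt (i + 1)).2
  /-- No vertex lies on an edge of which it is not an end point. -/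
  vertex_notMem : ∀ i j, i ≠ j → i ≠ j + 1 → pt i ∉ segment ℝ (pt j) (pt (j + 1))
  /-- There are no triple points. -/
  no_triple : ∀ i j k, i ≠ j → j ≠ k → i ≠ k →
    segment ℝ (pt i) (pt (i + 1)) ∩ segment ℝ (pt j) (pt (j + 1)) ∩
      segment ℝ (pt k) (pt (k + 1)) = ∅
  /-- `passesOver i j`: the `i`-th edge passes over the `j`-th edge at a classical crossing. -/
  passesOver : Fin (n + 3) → Fin (n + 3) → Prop
  /-- Classical crossings are intersection points of non-adjacent edges; all other such
  intersection points are virtual crossings. -/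
  passesOver_crosses : ∀ i j, passesOver i j → i ≠ j ∧ i ≠ j + 1 ∧ j ≠ i + 1 ∧
    (segment ℝ (pt i) (pt (i + 1)) ∩ segment ℝ (pt j) (pt (j + 1))).Nonempty
  passesOver_asymm : ∀ i j, passesOver i j → ¬ passesOver j i

/-- The direction of the `i`-th edge. -/
def Diagram.dir (D : Diagram) (i : Fin (D.n + 3)) : ℝ × ℝ := D.pt (i + 1) - D.pt i

/-- `w` is the oriented Gauss code read off from `D` while travelling once around the polygon,
starting at vertex `0`.  The `a`-th letter belongs to the passage of the edge `e a` through the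
classical crossing with the edge `f a`, at the time `t a ∈ [0, 1]` of the motion along `e a`; virtual
crossings are not recorded. -/
def Diagram.HasGaussCode (D : Diagram) (w : List Letter) : Prop :=
  ∃ (e f : Fin w.length → Fin (D.n + 3)) (t : Fin w.length → ℝ),
    (∀ a, t a ∈ Set.Icc (0 : ℝ) 1 ∧
      D.pt (e a) + t a • D.dir (e a) ∈ segment ℝ (D.pt (f a)) (D.pt (f a + 1))) ∧
    (StrictMono fun a => ((e a : ℕ) : ℝ) + t a) ∧
    (∀ i j, (D.passesOver i j ∨ D.passesOver j i) ↔ ∃ a, e a = i ∧ f a = j) ∧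
    (∀ a b, (w.get a).label = (w.get b).label ↔
      (e a = e b ∧ f a = f b) ∨ (e a = f b ∧ f a = e b)) ∧
    (∀ a, (w.get a).isOver = true ↔ D.passesOver (e a) (f a)) ∧
    (∀ a, (w.get a).sign = true ↔
      0 < if (w.get a).isOver then det (D.dir (e a)) (D.dir (f a))
        else det (D.dir (f a)) (D.dir (e a)))

/-- The number of local maxima of the height function on the polygon: vertices that are higher than
both neighbouring vertices. -/
noncomputable def Diagram.numMaxima (D : Diagram) : ℕ :=
  Set.ncard {i : Fin (D.n + 3) |
    (D.pt i).2 < (D.pt (i + 1)).2 ∧ (D.pt (i + 1 + 1)).2 < (D.pt (i + 1)).2}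

/-- The second bridge number: the minimal number of local maxima of a diagram of `K`. -/
noncomputable def VirtualKnot.secondBridgeNumber (K : VirtualKnot) : ℕ∞ :=
  ⨅ (D : Diagram) (w : List Letter) (_ : D.HasGaussCode w ∧ K.IsRepresentedBy w),
    (D.numMaxima : ℕ∞)

/-! ### The summands -/

/-- The bow-tie, cut open at one arc: a Kishino-type virtual knot with four classical crossings
(and two virtual ones in the plane). -/
def bowTie : List Letter :=
  [⟨0, true, false⟩, ⟨1, true, true⟩, ⟨0, false, false⟩, ⟨2, true, true⟩,
    ⟨3, true, true⟩, ⟨2, false, true⟩, ⟨3, false, true⟩, ⟨1, false, true⟩]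

/-- The standard three-crossing diagram of the trefoil, cut open at one arc. -/
def trefoil : List Letter :=
  [⟨0, true, true⟩, ⟨1, false, true⟩, ⟨2, true, true⟩,
    ⟨0, false, true⟩, ⟨1, true, true⟩, ⟨2, false, true⟩]

/-- Add `k` to all labels. -/
def shift (k : ℕ) (w : List Letter) : List Letter := w.map fun e => { e with label := e.label + k }

/-- `n` copies of the bow-tie and `r` copies of the trefoil, with disjoint sets of labels, joined
one after the other along a circle: the sum of `n` bow-ties with the `r`-fold connected sum of
trefoils. -/
def sumCode (n r : ℕ) : List Letter :=
  ((List.range n).flatMap fun i => shift (4 * i) bowTie) ++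
    ((List.range r).flatMap fun j => shift (4 * n + 3 * j) trefoil)

end VirtualBridge

namespace VirtualBridge

/-! ### Colorings of Gauss codes -/

/-! The lower bounds for both bridge numbers come from counting colorings of the arcs of a Gauss
code by a finite biquandle `X`. The count is an invariant of the virtual knot
(`mk_coloring_eq_of_isRepresentedBy`), and with a fixed color at the cut points it is at least
multiplicative under joining long words (`mk_longColoring_append_le`).

Second bridge number. In a biquandle, one color on the under-strand and one on the over-strand
determine all four colors at a crossing. Hence, moving down a diagram, a coloring is determined by
its color at the base point and its colors at the local maxima: both strands of a crossing reach it
from above with known colors. A diagram with `k` maxima thus has at most `|X| ^ (k + 1)` colorings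
(`Diagram.HasGaussCode.mk_coloring_le`). For the four-element `kishinoBiquandle` the bow-tie has at
least four colorings with color zero at both ends, so `n` bow-ties give at least `4 ^ n` colorings
and `n ≤ k + 1`.

First bridge number, lower bound. In a Fox 3-coloring the color is constant along an overbridge, and
the colors of the overbridges determine the rest, so there are at most `3 ^ overbridges` colorings;
`r` trefoils give at least `3 ^ (r + 1)`.

First bridge number, upper bound. An under-letter can be moved past a following over-letter of
another crossing by a second and a third Reidemeister move (`exists_sameKnot_swap`). This only
replaces some other letters by runs of letters of the same height, which creates no new bridge. In
this way a bow-tie turns into overs followed by unders and merges with what precedes it, at no cost,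
while a trefoil costs one bridge (`absorbs_bowTie`, `absorbs_trefoil`). Altogether `r + 1` bridges
suffice. -/

/-- The arcs of a strand that passes through two crossings, with incoming and outgoing colors `p`
and `q` respectively, in this order if `d = true` and in the opposite order otherwise; `s` and `t`
are the colors at the two ends. -/
def Through {X : Type} (d : Bool) (p q : X × X) (s t : X) : Prop :=
  if d then s = p.1 ∧ p.2 = q.1 ∧ q.2 = t else s = q.1 ∧ q.2 = p.1 ∧ p.2 = t

instance {X : Type} [DecidableEq X] (d : Bool) (p q : X × X) (s t : X) :
    Decidable (Through d p q s t) := by unfold Through; infer_instance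

/-- A biquandle structure, given by the colors `underColor s (u, o)` and
`overColor s (u, o)` of the outgoing under-arc and over-arc at a crossing of sign `s` whose incoming
under-arc and over-arc have the colors `u` and `o`. -/
structure Biquandle (X : Type) where
  underColor : Bool → X × X → X
  overColor : Bool → X × X → X
  ext_in : ∀ s p q, underColor s p = underColor s q → p.2 = q.2 → p = q
  ext_out : ∀ s p q, overColor s p = overColor s q → p.1 = q.1 → p = q
  ext_both : ∀ s p q, underColor s p = underColor s q → overColor s p = overColor s q → p = q
  r1_over_exists : ∀ s x, ∃ y, overColor s (y, x) = y ∧ underColor s (y, x) = x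
  r1_over_unique : ∀ s x y z, overColor s (y, x) = y → overColor s (z, x) = z → y = z
  r1_under_exists : ∀ s x, ∃ y, underColor s (x, y) = y ∧ overColor s (x, y) = x
  r1_under_unique : ∀ s x y z, underColor s (x, y) = y → underColor s (x, z) = z → y = z
  r2_exists : ∀ s d x y, ∃ p q : X × X,
    Through true (p.2, overColor s p) (q.2, overColor (!s) q) x x ∧
      Through d (p.1, underColor s p) (q.1, underColor (!s) q) y y
  r2_ends : ∀ s d (p q : X × X) x x' y y',
    Through true (p.2, overColor s p) (q.2, overColor (!s) q) x x' →
      Through d (p.1, underColor s p) (q.1, underColor (!s) q) y y' → x = x' ∧ y = y'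
  r3_exists : ∀ (ε x y z : Bool) (p q r : X × X) t t' m m' l l',
    Through (ε == (x == (y == z))) (p.2, overColor x p) (q.2, overColor y q) t t' →
    Through (ε == x) (p.1, underColor x p) (r.2, overColor z r) m m' →
    Through (ε == y) (q.1, underColor y q) (r.1, underColor z r) l l' →
    ∃ p q r : X × X,
      Through (!(ε == (x == (y == z)))) (p.2, overColor x p) (q.2, overColor y q) t t' ∧
      Through (!(ε == x)) (p.1, underColor x p) (r.2, overColor z r) m m' ∧
      Through (!(ε == y)) (q.1, underColor y q) (r.1, underColor z r) l l'

section Coloring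

variable {X : Type} (B : Biquandle X)

/-- The color of the arc that ends at the letter `e`, if `κ` gives the incoming colors. -/
def inColor (κ : ℕ → X × X) (e : Letter) : X :=
  if e.isOver then (κ e.label).2 else (κ e.label).1

/-- The color of the arc that starts at the letter `e`. -/
def outColor (κ : ℕ → X × X) (e : Letter) : X :=
  if e.isOver then B.overColor e.sign (κ e.label) else B.underColor e.sign (κ e.label)

/-- The incoming colors `κ` at the crossings fit together along the word, from `s` to `t`. -/
def Fits (κ : ℕ → X × X) : List Letter → X → X → Prop
  | [], s, t => s = t
  | e :: w, s, t => s = inColor κ e ∧ Fits κ w (outColor B κ e) t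

variable {B}

theorem fits_append {κ : ℕ → X × X} {u v : List Letter} {s t : X} :
    Fits B κ (u ++ v) s t ↔ ∃ m, Fits B κ u s m ∧ Fits B κ v m t := by
  induction u generalizing s with
  | nil => simp [Fits]
  | cons e u ih => simp [Fits, ih, and_assoc]

theorem Fits.unique {κ : ℕ → X × X} {w : List Letter} {s t t' : X}
    (h : Fits B κ w s t) (h' : Fits B κ w s t') : t = t' := by
  induction w generalizing s with
  | nil => exact h.symm.trans h'
  | cons e w ih => exact ih h.2 h'.2

theorem fits_congr {κ κ' : ℕ → X × X} {w : List Letter}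
    (h : ∀ e ∈ w, κ e.label = κ' e.label) {s t : X} : Fits B κ w s t ↔ Fits B κ' w s t := by
  induction w generalizing s with
  | nil => rfl
  | cons e w ih =>
    have he := h e (by simp)
    simp only [Fits, inColor, outColor, he, ih fun e he => h e (by simp [he])]

/-- The word `w`, with its labels renamed by `f`. -/
def relabel (f : ℕ → ℕ) (w : List Letter) : List Letter :=
  w.map fun e => ⟨f e.label, e.isOver, e.sign⟩

theorem fits_relabel {f : ℕ → ℕ} {κ κ' : ℕ → X × X} {w : List Letter}
    (h : ∀ e ∈ w, κ' (f e.label) = κ e.label) {s t : X} :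
    Fits B κ' (relabel f w) s t ↔ Fits B κ w s t := by
  induction w generalizing s with
  | nil => rfl
  | cons e w ih =>
    have he := h e (by simp)
    have ih' := @ih fun e he => h e (by simp [he])
    simp only [relabel, List.map_cons, Fits, inColor, outColor, he] at ih' ⊢
    rw [ih']

theorem fits_inOrder {κ : ℕ → X × X} {e f : Letter} {d : Bool} {s t : X} :
    Fits B κ (inOrder d e f) s t ↔
      Through d (inColor κ e, outColor B κ e) (inColor κ f, outColor B κ f) s t := by
  cases d <;> simp [inOrder, Through, Fits, inColor, outColor]

/-- The labels of a word. -/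
def labels (w : List Letter) : List ℕ := w.map Letter.label

theorem label_mem_labels {e : Letter} {w : List Letter} (h : e ∈ w) : e.label ∈ labels w :=
  List.mem_map_of_mem h

variable (B) in
/-- The colorings of the long word `w` whose ends both have the color `s`. -/
def LongColoring [Inhabited X] (w : List Letter) (s : X) : Type :=
  -- The default value off the labels of `w` ensures that only the colors at crossings of `w` are
  -- counted.
  {κ : ℕ → X × X // Fits B κ w s s ∧ ∀ a, a ∉ labels w → κ a = default}

variable (B) in
/-- The colorings of the cyclic word `w`. -/
def Coloring [Inhabited X] (w : List Letter) : Type := Σ s : X, LongColoring B w s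

variable [Inhabited X]

open Cardinal in
/-- Replacing three parts of a word by others that allow at least the same colors at the ends does not
decrease the number of colorings. -/
theorem mk_coloring_le_of_local {L₀ L₁ L₂ M₀ M₁ M₂ u v w : List Letter}
    (hM : ∀ e ∈ u ++ v ++ w, e.label ∉ labels (M₀ ++ M₁ ++ M₂))
    (hex : ∀ (κ : ℕ → X × X) s₀ t₀ s₁ t₁ s₂ t₂,
      Fits B κ L₀ s₀ t₀ → Fits B κ L₁ s₁ t₁ → Fits B κ L₂ s₂ t₂ →
      ∃ κ', Fits B κ' M₀ s₀ t₀ ∧ Fits B κ' M₁ s₁ t₁ ∧ Fits B κ' M₂ s₂ t₂)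
    (huniq : ∀ (κ κ' : ℕ → X × X) s₀ t₀ s₁ t₁ s₂ t₂,
      Fits B κ L₀ s₀ t₀ → Fits B κ L₁ s₁ t₁ → Fits B κ L₂ s₂ t₂ →
      Fits B κ' L₀ s₀ t₀ → Fits B κ' L₁ s₁ t₁ → Fits B κ' L₂ s₂ t₂ →
      ∀ a ∈ labels (L₀ ++ L₁ ++ L₂), κ a = κ' a) :
    #(Coloring B (L₀ ++ u ++ L₁ ++ v ++ L₂ ++ w)) ≤
      #(Coloring B (M₀ ++ u ++ M₁ ++ v ++ M₂ ++ w)) := by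
  classical
  have key : ∀ p : Coloring B (L₀ ++ u ++ L₁ ++ v ++ L₂ ++ w),
      ∃ q : Coloring B (M₀ ++ u ++ M₁ ++ v ++ M₂ ++ w), p.1 = q.1 ∧
        (∀ e ∈ u ++ v ++ w, q.2.1 e.label = p.2.1 e.label) ∧
        ∃ t₀ s₁ t₁ s₂ t₂,
          (Fits B p.2.1 L₀ p.1 t₀ ∧ Fits B p.2.1 L₁ s₁ t₁ ∧ Fits B p.2.1 L₂ s₂ t₂) ∧
          Fits B q.2.1 M₀ p.1 t₀ ∧ Fits B q.2.1 u t₀ s₁ ∧ Fits B q.2.1 M₁ s₁ t₁ ∧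
          Fits B q.2.1 v t₁ s₂ ∧ Fits B q.2.1 M₂ s₂ t₂ := by
    rintro ⟨s, κ, hκ, hs⟩
    simp only [fits_append] at hκ
    obtain ⟨t₂, ⟨s₂, ⟨t₁, ⟨s₁, ⟨t₀, h0, hu⟩, h1⟩, hv⟩, h2⟩, hw⟩ := hκ
    obtain ⟨κ', k0, k1, k2⟩ := hex κ _ _ _ _ _ _ h0 h1 h2
    -- Glue the new colors inside to the old ones outside; `hM` makes the two sets of labels
    -- disjoint.
    set ρ : ℕ → X × X := fun a =>
      if a ∈ labels (M₀ ++ M₁ ++ M₂) then κ' a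
      else if a ∈ labels (u ++ v ++ w) then κ a else default with hρ
    have ho : ∀ e ∈ u ++ v ++ w, ρ e.label = κ e.label := by
      intro e he
      rw [hρ]
      simp only
      rw [if_neg (hM e he), if_pos (label_mem_labels he)]
    have hi : ∀ e ∈ M₀ ++ M₁ ++ M₂, ρ e.label = κ' e.label := by
      intro e he
      rw [hρ]
      simp only
      rw [if_pos (label_mem_labels he)]
    have k0' := (fits_congr (B := B) fun e he => hi e (by simp [he])).2 k0
    have k1' := (fits_congr (B := B) fun e he => hi e (by simp [he])).2 k1
    have k2' := (fits_congr (B := B) fun e he => hi e (by simp [he])).2 k2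
    have hu' := (fits_congr (B := B) fun e he => ho e (by simp [he])).2 hu
    have hv' := (fits_congr (B := B) fun e he => ho e (by simp [he])).2 hv
    have hw' := (fits_congr (B := B) fun e he => ho e (by simp [he])).2 hw
    refine ⟨⟨s, ρ, ?_, ?_⟩, rfl, ho, t₀, s₁, t₁, s₂, t₂, ⟨h0, h1, h2⟩, k0', hu', k1', hv', k2'⟩
    · simp only [fits_append]
      exact ⟨t₂, ⟨s₂, ⟨t₁, ⟨s₁, ⟨t₀, k0', hu'⟩, k1'⟩, hv'⟩, k2'⟩, hw'⟩
    · intro a ha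
      simp only [hρ]
      simp only [labels, List.map_append, List.mem_append] at ha ⊢
      rw [if_neg (by tauto), if_neg (by tauto)]
  choose F hF1 hFo hF using key
  refine mk_le_of_injective (f := F) fun p p' hpp => ?_
  have hs : p.1 = p'.1 := by rw [hF1, hF1, hpp]
  obtain ⟨t₀, s₁, t₁, s₂, t₂, ⟨a0, a1, a2⟩, b0, bu, b1, bv, b2⟩ := hF p
  obtain ⟨t₀', s₁', t₁', s₂', t₂', ⟨a0', a1', a2'⟩, b0', bu', b1', bv', b2'⟩ := hF p'
  have o := hFo p
  have o' := hFo p'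
  replace b0' := (congrArg (fun z => Fits B _ M₀ z t₀') hs).mpr b0'
  replace a0' := (congrArg (fun z => Fits B _ L₀ z t₀') hs).mpr a0'
  rw [← hpp] at b0' bu' b1' bv' b2' o'
  -- Walking along the common image from the base color recovers the end colors of all three parts;
  -- `huniq` then recovers the colors inside them.
  obtain rfl := b0.unique b0'
  obtain rfl := bu.unique bu'
  obtain rfl := b1.unique b1'
  obtain rfl := bv.unique bv'
  obtain rfl := b2.unique b2'
  have hin := huniq _ _ _ _ _ _ _ _ a0 a1 a2 a0' a1' a2'
  obtain ⟨s, κ, hκ, hd⟩ := p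
  obtain ⟨s', κ', hκ', hd'⟩ := p'
  obtain rfl : s = s' := hs
  congr 2
  funext a
  by_cases h1 : a ∈ labels (L₀ ++ L₁ ++ L₂)
  · exact hin a h1
  by_cases h2 : a ∈ labels (u ++ v ++ w)
  · obtain ⟨e, he, rfl⟩ := List.mem_map.1 h2
    exact (o e he).symm.trans (o' e he)
  have : a ∉ labels (L₀ ++ u ++ L₁ ++ v ++ L₂ ++ w) := by
    simp only [labels, List.map_append, List.mem_append] at h1 h2 ⊢
    tauto
  exact (hd a this).trans (hd' a this).symm

open Cardinal

theorem mk_coloring_rotate_le (u v : List Letter) :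
    #(Coloring B (u ++ v)) ≤ #(Coloring B (v ++ u)) := by
  have key : ∀ p : Coloring B (u ++ v), ∃ q : Coloring B (v ++ u), q.2.1 = p.2.1 ∧
      Fits B p.2.1 u p.1 q.1 ∧ Fits B p.2.1 v q.1 p.1 := by
    rintro ⟨s, κ, hκ, hd⟩
    obtain ⟨m, h1, h2⟩ := fits_append.1 hκ
    refine ⟨⟨m, κ, fits_append.2 ⟨s, h2, h1⟩, fun a ha => hd a ?_⟩, rfl, h1, h2⟩
    simp only [labels, List.map_append, List.mem_append] at ha ⊢
    tauto
  choose F h1 hu hv using key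
  refine mk_le_of_injective (f := F) fun p p' hpp => ?_
  have hκ : p.2.1 = p'.2.1 := by rw [← h1, ← h1, hpp]
  have hs : p.1 = p'.1 := by
    have a := hv p
    have a' := hv p'
    rw [← hκ, ← hpp] at a'
    exact a.unique a'
  obtain ⟨s, κ, h⟩ := p
  obtain ⟨s', κ', h'⟩ := p'
  obtain rfl : s = s' := hs
  obtain rfl : κ = κ' := hκ
  rfl

theorem mk_longColoring_relabel_le {f : ℕ → ℕ} (hf : f.Injective) (w : List Letter) (s : X) :
    #(LongColoring B w s) ≤ #(LongColoring B (relabel f w) s) := by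
  classical
  have key : ∀ κ : LongColoring B w s, ∃ κ' : LongColoring B (relabel f w) s,
      ∀ a, κ'.1 (f a) = κ.1 a := by
    rintro ⟨κ, hκ, hd⟩
    have hg : ∀ a, Function.extend f κ (fun _ => default) (f a) = κ a := fun a =>
      hf.extend_apply _ _ _
    refine ⟨⟨Function.extend f κ (fun _ => default), ?_, fun a ha => ?_⟩, hg⟩
    · exact (fits_relabel fun e _ => hg _).2 hκ
    · by_cases h : ∃ b, f b = a
      · obtain ⟨b, rfl⟩ := h
        rw [hg]
        refine hd b fun hb => ha ?_
        obtain ⟨e, he, rfl⟩ := List.mem_map.1 hb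
        simp only [labels, relabel, List.map_map, List.mem_map]
        exact ⟨e, he, rfl⟩
      · exact Function.extend_apply' _ _ _ h
  choose F hF using key
  refine mk_le_of_injective (f := F) fun p p' hpp => Subtype.ext (funext fun a => ?_)
  rw [← hF, ← hF, hpp]

theorem mk_coloring (w : List Letter) :
    #(Coloring B w) = Cardinal.sum fun s => #(LongColoring B w s) :=
  mk_sigma _

theorem mk_coloring_relabel_le {f : ℕ → ℕ} (hf : f.Injective) (w : List Letter) :
    #(Coloring B w) ≤ #(Coloring B (relabel f w)) := by
  rw [mk_coloring, mk_coloring]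
  exact sum_le_sum _ _ fun s => mk_longColoring_relabel_le hf w s

theorem mk_coloring_perm (σ : Equiv.Perm ℕ) (w : List Letter) :
    #(Coloring B w) = #(Coloring B (relabel σ w)) := by
  refine (mk_coloring_relabel_le σ.injective w).antisymm ?_
  have h := mk_coloring_relabel_le (B := B) σ.symm.injective (relabel σ w)
  have : relabel σ.symm (relabel σ w) = w := by
    simp [relabel, Function.comp_def]
  rwa [this] at h

end Coloring

/-! ### Invariance of the number of colorings -/

section Invariance

open Cardinal

variable {X : Type} {B : Biquandle X}

/-- A crossing is determined by one color on the under-strand and one color on the over-strand. -/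
theorem Biquandle.crossing_ext (B : Biquandle X) (s : Bool) {p q : X × X}
    (hu : p.1 = q.1 ∨ B.underColor s p = B.underColor s q)
    (ho : p.2 = q.2 ∨ B.overColor s p = B.overColor s q) : p = q := by
  rcases hu with hu | hu <;> rcases ho with ho | ho
  · exact Prod.ext hu ho
  · exact B.ext_out s p q ho hu
  · exact B.ext_in s p q hu ho
  · exact B.ext_both s p q hu ho

/-- An end of the strand is adjacent to the passage `p`: its entry if `d = true`, its exit
otherwise. This supplies one of the two colors that `Biquandle.crossing_ext` needs. -/
theorem Through.left_eq {d : Bool} {p q p' q' : X × X} {s t : X} (h : Through d p q s t)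
    (h' : Through d p' q' s t) : p.1 = p'.1 ∨ p.2 = p'.2 := by
  cases d
  · exact .inr (h.2.2.trans h'.2.2.symm)
  · exact .inl (h.1.symm.trans h'.1)

theorem Through.right_eq {d : Bool} {p q p' q' : X × X} {s t : X} (h : Through d p q s t)
    (h' : Through d p' q' s t) : q.1 = q'.1 ∨ q.2 = q'.2 := by
  cases d
  · exact .inl (h.1.symm.trans h'.1)
  · exact .inr (h.2.2.trans h'.2.2.symm)

/-- The passages of the top strand in a third Reidemeister move, before (`ε = true`) or after it. -/
def topPair (a b : ℕ) (x y z ε : Bool) : List Letter :=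
  inOrder (ε == (x == (y == z))) ⟨a, true, x⟩ ⟨b, true, y⟩

/-- The passages of the middle strand in a third Reidemeister move. -/
def middlePair (a c : ℕ) (x z ε : Bool) : List Letter :=
  inOrder (ε == x) ⟨a, false, x⟩ ⟨c, true, z⟩

/-- The passages of the bottom strand in a third Reidemeister move. -/
def bottomPair (b c : ℕ) (y z ε : Bool) : List Letter :=
  inOrder (ε == y) ⟨b, false, y⟩ ⟨c, false, z⟩

section R3

variable {a b c : ℕ} {x y z ε : Bool} {κ : ℕ → X × X} {s t : X}

theorem fits_topPair : Fits B κ (topPair a b x y z ε) s t ↔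
    Through (ε == (x == (y == z))) ((κ a).2, B.overColor x (κ a)) ((κ b).2, B.overColor y (κ b))
      s t := by
  simp [topPair, fits_inOrder, inColor, outColor]

theorem fits_middlePair : Fits B κ (middlePair a c x z ε) s t ↔
    Through (ε == x) ((κ a).1, B.underColor x (κ a)) ((κ c).2, B.overColor z (κ c)) s t := by
  simp [middlePair, fits_inOrder, inColor, outColor]

theorem fits_bottomPair : Fits B κ (bottomPair b c y z ε) s t ↔
    Through (ε == y) ((κ b).1, B.underColor y (κ b)) ((κ c).1, B.underColor z (κ c)) s t := by
  simp [bottomPair, fits_inOrder, inColor, outColor]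

theorem r3_fits_exists (hab : a ≠ b) (hac : a ≠ c) (hbc : b ≠ c) {t t' m m' l l' : X}
    (ht : Fits B κ (topPair a b x y z ε) t t') (hm : Fits B κ (middlePair a c x z ε) m m')
    (hl : Fits B κ (bottomPair b c y z ε) l l') :
    ∃ κ', Fits B κ' (topPair a b x y z (!ε)) t t' ∧ Fits B κ' (middlePair a c x z (!ε)) m m' ∧
      Fits B κ' (bottomPair b c y z (!ε)) l l' := by
  rw [fits_topPair] at ht
  rw [fits_middlePair] at hm
  rw [fits_bottomPair] at hl
  obtain ⟨p, q, r, h1, h2, h3⟩ := B.r3_exists ε x y z _ _ _ _ _ _ _ _ _ ht hm hl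
  refine ⟨fun d => if d = a then p else if d = b then q else r, ?_⟩
  have hε : ∀ β : Bool, ((!ε) == β) = !(ε == β) := by cases ε <;> decide
  simpa [fits_topPair, fits_middlePair, fits_bottomPair, hab.symm, hac.symm, hbc.symm, hε] using
    And.intro h1 (And.intro h2 h3)

/-- Each crossing lies on two of the three strands and is next to an end of each, so one color on
either strand is known there. -/
theorem r3_fits_unique {κ' : ℕ → X × X} {t t' m m' l l' : X}
    (ht : Fits B κ (topPair a b x y z ε) t t') (hm : Fits B κ (middlePair a c x z ε) m m')
    (hl : Fits B κ (bottomPair b c y z ε) l l')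
    (ht' : Fits B κ' (topPair a b x y z ε) t t') (hm' : Fits B κ' (middlePair a c x z ε) m m')
    (hl' : Fits B κ' (bottomPair b c y z ε) l l') : κ a = κ' a ∧ κ b = κ' b ∧ κ c = κ' c := by
  rw [fits_topPair] at ht ht'
  rw [fits_middlePair] at hm hm'
  rw [fits_bottomPair] at hl hl'
  exact ⟨B.crossing_ext x (hm.left_eq hm') (ht.left_eq ht'),
    B.crossing_ext y (hl.left_eq hl') (ht.right_eq ht'),
    B.crossing_ext z (hl.right_eq hl') (hm.right_eq hm')⟩

end R3

variable [Inhabited X]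

theorem mk_coloring_r1 {a : ℕ} (o s : Bool) {w : List Letter} (ha : a ∉ labels w) :
    #(Coloring B w) = #(Coloring B (⟨a, o, s⟩ :: ⟨a, !o, s⟩ :: w)) := by
  have hd : ∀ e ∈ w, e.label ≠ a := fun e he h => ha (h ▸ label_mem_labels he)
  -- The color of the loop is unique, hence is the one from the existence axiom, for which the exit
  -- color equals the entry color.
  have hends : ∀ (κ : ℕ → X × X) x y,
      Fits B κ [⟨a, o, s⟩, ⟨a, !o, s⟩] x y → x = y := by
    intro κ x y h
    cases o
    · obtain ⟨rfl, h2, h3⟩ : x = (κ a).1 ∧ B.underColor s (κ a) = (κ a).2 ∧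
        B.overColor s (κ a) = y := by simpa [Fits, inColor, outColor] using h
      obtain ⟨z, hz, hz'⟩ := B.r1_under_exists s (κ a).1
      have := B.r1_under_unique s _ _ _ h2 hz
      rw [← h3, ← hz', ← this]
    · obtain ⟨rfl, h2, h3⟩ : x = (κ a).2 ∧ B.overColor s (κ a) = (κ a).1 ∧
        B.underColor s (κ a) = y := by simpa [Fits, inColor, outColor] using h
      obtain ⟨z, hz, hz'⟩ := B.r1_over_exists s (κ a).2
      have := B.r1_over_unique s _ _ _ h2 hz
      rw [← h3, ← hz', ← this]
  apply le_antisymm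
  · have := mk_coloring_le_of_local (B := B) (L₀ := []) (L₁ := []) (L₂ := [])
      (M₀ := [⟨a, o, s⟩, ⟨a, !o, s⟩]) (M₁ := []) (M₂ := []) (u := []) (v := []) (w := w)
      (by simpa [labels] using hd) ?_ (by simp [labels])
    · simpa using this
    · rintro κ x _ x₁ _ x₂ _ rfl rfl rfl
      cases o
      · obtain ⟨z, hz, hz'⟩ := B.r1_under_exists s x
        exact ⟨fun _ => (x, z), by simp [Fits, inColor, outColor, hz, hz'], rfl, rfl⟩
      · obtain ⟨z, hz, hz'⟩ := B.r1_over_exists s x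
        exact ⟨fun _ => (z, x), by simp [Fits, inColor, outColor, hz, hz'], rfl, rfl⟩
  · have := mk_coloring_le_of_local (B := B) (M₀ := []) (M₁ := []) (M₂ := [])
      (L₀ := [⟨a, o, s⟩, ⟨a, !o, s⟩]) (L₁ := []) (L₂ := []) (u := []) (v := []) (w := w)
      (by simp [labels]) ?_ ?_
    · simpa using this
    · intro κ x y x₁ y₁ x₂ y₂ h h1 h2
      exact ⟨κ, hends κ x y h, h1, h2⟩
    · intro κ κ' x y _ _ _ _ h _ _ h' _ _ b hb
      obtain rfl : b = a := by simpa [labels] using hb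
      cases o
      · obtain ⟨h1, h2, -⟩ : x = (κ b).1 ∧ B.underColor s (κ b) = (κ b).2 ∧
          B.overColor s (κ b) = y := by simpa [Fits, inColor, outColor] using h
        obtain ⟨h1', h2', -⟩ : x = (κ' b).1 ∧ B.underColor s (κ' b) = (κ' b).2 ∧
          B.overColor s (κ' b) = y := by simpa [Fits, inColor, outColor] using h'
        have e : (κ b).1 = (κ' b).1 := h1.symm.trans h1'
        refine Prod.ext e (B.r1_under_unique s (κ b).1 _ _ h2 ?_)
        rw [e]
        exact h2'
      · obtain ⟨h1, h2, -⟩ : x = (κ b).2 ∧ B.overColor s (κ b) = (κ b).1 ∧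
          B.underColor s (κ b) = y := by simpa [Fits, inColor, outColor] using h
        obtain ⟨h1', h2', -⟩ : x = (κ' b).2 ∧ B.overColor s (κ' b) = (κ' b).1 ∧
          B.underColor s (κ' b) = y := by simpa [Fits, inColor, outColor] using h'
        have e : (κ b).2 = (κ' b).2 := h1.symm.trans h1'
        refine Prod.ext (B.r1_over_unique s (κ b).2 _ _ h2 ?_) e
        rw [e]
        exact h2'

theorem labels_inOrder {d : Bool} {e f : Letter} {a : ℕ} :
    a ∈ labels (inOrder d e f) ↔ a = e.label ∨ a = f.label := by
  cases d <;> simp [labels, inOrder, or_comm]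

theorem labels_append {u v : List Letter} {a : ℕ} :
    a ∈ labels (u ++ v) ↔ a ∈ labels u ∨ a ∈ labels v := by
  simp [labels]

theorem mk_coloring_r2 {a b : ℕ} (s d : Bool) {u v : List Letter} (hab : a ≠ b)
    (ha : a ∉ labels (u ++ v)) (hb : b ∉ labels (u ++ v)) :
    #(Coloring B (u ++ v)) = #(Coloring B (inOrder true ⟨a, true, s⟩ ⟨b, true, !s⟩ ++ u ++
      inOrder d ⟨a, false, s⟩ ⟨b, false, !s⟩ ++ v)) := by
  have hd : ∀ e ∈ u ++ v ++ [], e.label ∉ labels (inOrder true ⟨a, true, s⟩ ⟨b, true, !s⟩ ++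
      inOrder d ⟨a, false, s⟩ ⟨b, false, !s⟩ ++ []) := by
    intro e he
    rw [List.append_nil] at he
    have ha' : e.label ≠ a := fun h => ha (h ▸ label_mem_labels he)
    have hb' : e.label ≠ b := fun h => hb (h ▸ label_mem_labels he)
    rw [labels_append, labels_append, labels_inOrder, labels_inOrder]
    simp [labels, ha', hb']
  apply le_antisymm
  · have := mk_coloring_le_of_local (B := B) (L₀ := []) (L₁ := []) (L₂ := [])
      (M₀ := inOrder true ⟨a, true, s⟩ ⟨b, true, !s⟩)
      (M₁ := inOrder d ⟨a, false, s⟩ ⟨b, false, !s⟩) (M₂ := []) (u := u) (v := v) (w := [])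
      hd ?_ (by simp [labels])
    · simpa using this
    · rintro κ x _ y _ z _ rfl rfl rfl
      obtain ⟨p, q, h1, h2⟩ := B.r2_exists s d x y
      refine ⟨fun c => if c = a then p else q, ?_, ?_, rfl⟩
      · simpa [fits_inOrder, inColor, outColor, hab.symm] using h1
      · simpa [fits_inOrder, inColor, outColor, hab.symm] using h2
  · have := mk_coloring_le_of_local (B := B) (M₀ := []) (M₁ := []) (M₂ := [])
      (L₀ := inOrder true ⟨a, true, s⟩ ⟨b, true, !s⟩)
      (L₁ := inOrder d ⟨a, false, s⟩ ⟨b, false, !s⟩) (L₂ := []) (u := u) (v := v) (w := [])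
      (by simp [labels]) ?_ ?_
    · simpa using this
    · intro κ x x' y y' _ _ h h' h''
      rw [fits_inOrder] at h h'
      simp only [inColor, outColor, if_true, Bool.false_eq_true, if_false] at h h'
      obtain ⟨h1, h2⟩ := B.r2_ends s d _ _ _ _ _ _ h h'
      exact ⟨κ, h1, h2, h''⟩
    · intro κ κ' x x' y y' _ _ h1 h2 _ k1 k2 _ c hc
      rw [fits_inOrder] at h1 h2 k1 k2
      simp only [inColor, outColor, if_true, Bool.false_eq_true, if_false] at h1 h2 k1 k2
      simp only [labels_append, labels_inOrder] at hc
      have e1 : κ a = κ' a := B.crossing_ext s (h2.left_eq k2) (h1.left_eq k1)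
      have e2 : κ b = κ' b := B.crossing_ext (!s) (h2.right_eq k2) (h1.right_eq k1)
      rcases hc with ((rfl | rfl) | (rfl | rfl)) | hc
      any_goals assumption
      simp [labels] at hc

section R3

variable {a b c : ℕ} {x y z ε : Bool} {κ : ℕ → X × X}

theorem mem_labels_r3 (a b c : ℕ) (x y z ε : Bool) {d : ℕ} :
    (d ∈ labels (topPair a b x y z ε) ↔ d = a ∨ d = b) ∧
      (d ∈ labels (middlePair a c x z ε) ↔ d = a ∨ d = c) ∧
      (d ∈ labels (bottomPair b c y z ε) ↔ d = b ∨ d = c) := by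
  simp [topPair, middlePair, bottomPair, labels_inOrder]

/-- Because `ε` is arbitrary, this inequality also holds for the inverse move, and the two together
give equality. -/
theorem mk_coloring_r3_le (hab : a ≠ b) (hac : a ≠ c) (hbc : b ≠ c) {u v w : List Letter}
    (hd : ∀ e ∈ u ++ v ++ w, e.label ≠ a ∧ e.label ≠ b ∧ e.label ≠ c) :
    #(Coloring B (topPair a b x y z ε ++ u ++ middlePair a c x z ε ++ v ++
        bottomPair b c y z ε ++ w)) ≤
      #(Coloring B (topPair a b x y z (!ε) ++ u ++ middlePair a c x z (!ε) ++ v ++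
        bottomPair b c y z (!ε) ++ w)) := by
  have hl : ∀ ε, ∀ e ∈ u ++ v ++ w, e.label ∉ labels (topPair a b x y z ε ++
      middlePair a c x z ε ++ bottomPair b c y z ε) := by
    intro ε e he
    have := hd e he
    simp only [labels_append, mem_labels_r3 a b c x y z (d := e.label)]
    tauto
  refine mk_coloring_le_of_local (hl _) ?_ ?_
  · intro κ t t' m m' l l' h1 h2 h3
    exact r3_fits_exists hab hac hbc h1 h2 h3
  · intro κ κ' t t' m m' l l' h1 h2 h3 k1 k2 k3 d hd
    obtain ⟨e1, e2, e3⟩ := r3_fits_unique h1 h2 h3 k1 k2 k3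
    simp only [labels_append, mem_labels_r3 a b c x y z (d := d)] at hd
    rcases hd with ((rfl | rfl) | (rfl | rfl)) | (rfl | rfl) <;> assumption

theorem mk_coloring_r3'_le (hab : a ≠ b) (hac : a ≠ c) (hbc : b ≠ c) {u v w : List Letter}
    (hd : ∀ e ∈ u ++ v ++ w, e.label ≠ a ∧ e.label ≠ b ∧ e.label ≠ c) :
    #(Coloring B (topPair a b x y z ε ++ u ++ bottomPair b c y z ε ++ v ++
        middlePair a c x z ε ++ w)) ≤
      #(Coloring B (topPair a b x y z (!ε) ++ u ++ bottomPair b c y z (!ε) ++ v ++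
        middlePair a c x z (!ε) ++ w)) := by
  have hl : ∀ ε, ∀ e ∈ u ++ v ++ w, e.label ∉ labels (topPair a b x y z ε ++
      bottomPair b c y z ε ++ middlePair a c x z ε) := by
    intro ε e he
    have := hd e he
    simp only [labels_append, mem_labels_r3 a b c x y z (d := e.label)]
    tauto
  refine mk_coloring_le_of_local (hl _) ?_ ?_
  · intro κ t t' m m' l l' h1 h2 h3
    obtain ⟨κ', k1, k2, k3⟩ := r3_fits_exists hab hac hbc h1 h3 h2
    exact ⟨κ', k1, k3, k2⟩
  · intro κ κ' t t' m m' l l' h1 h2 h3 k1 k2 k3 d hd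
    obtain ⟨e1, e2, e3⟩ := r3_fits_unique h1 h3 h2 k1 k3 k2
    simp only [labels_append, mem_labels_r3 a b c x y z (d := d)] at hd
    rcases hd with ((rfl | rfl) | (rfl | rfl)) | (rfl | rfl) <;> assumption

end R3

/-! ### Gauss codes up to permutation, and freshness of labels -/

theorem inOrder_perm (d : Bool) (e f : Letter) : (inOrder d e f).Perm [e, f] := by
  cases d
  · exact List.Perm.swap _ _ _
  · exact List.Perm.refl _

theorem isGaussCode_perm {w w' : List Letter} (h : w.Perm w') :
    IsGaussCode w ↔ IsGaussCode w' := by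
  simp only [IsGaussCode, (h.map _).nodup_iff, h.mem_iff]

/-- Being a Gauss code does not depend on the order of the letters. After the letters of the
crossings in a move are brought to the front, this shows that their labels are distinct and absent
from the rest. -/
theorem isGaussCode_cons_cons {a : ℕ} {s : Bool} {w : List Letter} :
    IsGaussCode (⟨a, true, s⟩ :: ⟨a, false, s⟩ :: w) ↔ a ∉ labels w ∧ IsGaussCode w := by
  have hw : (∃ o, (a, o) ∈ w.map fun e => (e.label, e.isOver)) ↔ a ∈ labels w := by
    simp only [labels, List.mem_map, Prod.mk.injEq]
    exact ⟨fun ⟨o, e, he, h, _⟩ => ⟨e, he, h⟩, fun ⟨e, he, h⟩ => ⟨_, e, he, h, rfl⟩⟩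
  constructor
  · rintro ⟨h1, h2⟩
    simp only [List.map_cons, List.nodup_cons, List.mem_cons, not_or] at h1
    have ha : a ∉ labels w := by
      rw [← hw]
      rintro ⟨_ | _, h⟩
      exacts [h1.2.1 h, h1.1.2 h]
    refine ⟨ha, h1.2.2, fun e he => ?_⟩
    have hne : e.label ≠ a := fun h => ha (h ▸ label_mem_labels he)
    have := h2 e (by simp [he])
    simpa [Letter.partner, hne] using this
  · rintro ⟨ha, h1, h2⟩
    rw [← hw] at ha
    refine ⟨?_, fun e he => ?_⟩
    · simp only [List.map_cons, List.nodup_cons, List.mem_cons, not_or]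
      exact ⟨⟨by simp, fun h => ha ⟨_, h⟩⟩, fun h => ha ⟨_, h⟩, h1⟩
    · simp only [List.mem_cons] at he ⊢
      rcases he with rfl | rfl | he
      · simp [Letter.partner]
      · simp [Letter.partner]
      · exact .inr (.inr (h2 e he))

theorem r2_perm (a b : ℕ) (s s' d d' : Bool) (u v : List Letter) :
    (inOrder d' ⟨a, true, s⟩ ⟨b, true, s'⟩ ++ u ++
      inOrder d ⟨a, false, s⟩ ⟨b, false, s'⟩ ++ v).Perm
    (⟨a, true, s⟩ :: ⟨a, false, s⟩ :: ⟨b, true, s'⟩ :: ⟨b, false, s'⟩ :: (u ++ v)) := by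
  classical
  rw [List.perm_iff_count]
  intro q
  simp only [List.count_append, (inOrder_perm _ _ _).count_eq, List.count_cons, List.count_nil]
  ring

theorem r3_perm (a b c : ℕ) (x y z ε : Bool) (u v w : List Letter) :
    (topPair a b x y z ε ++ u ++ middlePair a c x z ε ++ v ++ bottomPair b c y z ε ++ w).Perm
    (⟨a, true, x⟩ :: ⟨a, false, x⟩ :: ⟨b, true, y⟩ :: ⟨b, false, y⟩ :: ⟨c, true, z⟩ ::
      ⟨c, false, z⟩ :: (u ++ v ++ w)) := by
  classical
  rw [List.perm_iff_count]
  intro q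
  simp only [topPair, middlePair, bottomPair, List.count_append, (inOrder_perm _ _ _).count_eq,
    List.count_cons, List.count_nil]
  ring

theorem r3'_perm (a b c : ℕ) (x y z ε : Bool) (u v w : List Letter) :
    (topPair a b x y z ε ++ u ++ bottomPair b c y z ε ++ v ++ middlePair a c x z ε ++ w).Perm
    (⟨a, true, x⟩ :: ⟨a, false, x⟩ :: ⟨b, true, y⟩ :: ⟨b, false, y⟩ :: ⟨c, true, z⟩ ::
      ⟨c, false, z⟩ :: (u ++ v ++ w)) := by
  classical
  rw [List.perm_iff_count]
  intro q
  simp only [topPair, middlePair, bottomPair, List.count_append, (inOrder_perm _ _ _).count_eq,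
    List.count_cons, List.count_nil]
  ring

theorem IsGaussCode.of_r3_perm {a b c : ℕ} {x y z : Bool} {u : List Letter}
    (h : IsGaussCode (⟨a, true, x⟩ :: ⟨a, false, x⟩ :: ⟨b, true, y⟩ :: ⟨b, false, y⟩ ::
      ⟨c, true, z⟩ :: ⟨c, false, z⟩ :: u)) :
    a ≠ b ∧ a ≠ c ∧ b ≠ c ∧ ∀ e ∈ u, e.label ≠ a ∧ e.label ≠ b ∧ e.label ≠ c := by
  simp only [isGaussCode_cons_cons] at h
  obtain ⟨ha, hb, hc, -⟩ := h
  simp only [labels, List.map_cons, List.mem_cons, not_or, List.mem_map, not_exists,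
    not_and] at ha hb hc
  exact ⟨ha.1, ha.2.2.1, hb.1, fun e he => ⟨ha.2.2.2.2 e he, hb.2.2 e he, hc e he⟩⟩

/-- `Move` by itself does not demand distinct or fresh labels; that both words are Gauss codes does.
-/
theorem IsGaussCode.mk_coloring_eq {w w' : List Letter} (hw : IsGaussCode w)
    (hw' : IsGaussCode w') (h : Move w w') : #(Coloring B w) = #(Coloring B w') := by
  cases h with
  | rotate u v => exact (mk_coloring_rotate_le u v).antisymm (mk_coloring_rotate_le v u)
  | rename σ w => exact mk_coloring_perm σ w
  | r1 a o s w =>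
    refine mk_coloring_r1 o s ?_
    have hp : (⟨a, o, s⟩ :: ⟨a, !o, s⟩ :: w : List Letter).Perm
        (⟨a, true, s⟩ :: ⟨a, false, s⟩ :: w) := by
      cases o
      · exact List.Perm.swap _ _ _
      · exact List.Perm.refl _
    exact (isGaussCode_cons_cons.1 ((isGaussCode_perm hp).1 hw')).1
  | r2 a b s d u v =>
    have h := (isGaussCode_perm (r2_perm a b s (!s) d true u v)).1 hw'
    simp only [isGaussCode_cons_cons] at h
    obtain ⟨ha, hb, -⟩ := h
    simp only [labels, List.map_cons, List.mem_cons, not_or] at ha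
    exact mk_coloring_r2 s d ha.1 ha.2.2 hb
  | r3 a b c x y z u v w =>
    have e1 := fun ε => mk_coloring_r3_le (B := B) (a := a) (b := b) (c := c) (x := x) (y := y)
      (z := z) (u := u) (v := v) (w := w) (ε := ε)
    have e2 := r3_perm a b c x y z true u v w
    simp only [topPair, middlePair, bottomPair, Bool.true_beq] at e2
    obtain ⟨h1, h2, h3, h4⟩ := ((isGaussCode_perm e2).1 hw).of_r3_perm
    simpa [topPair, middlePair, bottomPair] using
      (e1 true h1 h2 h3 h4).antisymm (e1 false h1 h2 h3 h4)
  | r3' a b c x y z u v w =>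
    have e1 := fun ε => mk_coloring_r3'_le (B := B) (a := a) (b := b) (c := c) (x := x) (y := y)
      (z := z) (u := u) (v := v) (w := w) (ε := ε)
    have e2 := r3'_perm a b c x y z true u v w
    simp only [topPair, middlePair, bottomPair, Bool.true_beq] at e2
    obtain ⟨h1, h2, h3, h4⟩ := ((isGaussCode_perm e2).1 hw).of_r3_perm
    simpa [topPair, middlePair, bottomPair] using
      (e1 true h1 h2 h3 h4).antisymm (e1 false h1 h2 h3 h4)

theorem mk_coloring_eq_of_isRepresentedBy {K : VirtualKnot} {w w' : List Letter}
    (h : K.IsRepresentedBy w) (h' : K.IsRepresentedBy w') :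
    #(Coloring B w) = #(Coloring B w') := by
  obtain ⟨hw, rfl⟩ := h
  obtain ⟨hw', h'⟩ := h'
  exact congrArg (Quot.lift (fun g : GaussCode => #(Coloring B g.1))
    fun g h hm => g.2.mk_coloring_eq h.2 hm) h'

end Invariance

/-! ### Two biquandles -/

instance {α β : Type} {P : α × β → Prop} [Decidable (∀ a b, P (a, b))] : Decidable (∀ p, P p) :=
  decidable_of_iff (∀ a b, P (a, b)) Prod.forall.symm

instance {α β : Type} {P : α × β → Prop} [Decidable (∃ a b, P (a, b))] : Decidable (∃ p, P p) :=
  decidable_of_iff (∃ a b, P (a, b)) Prod.exists.symm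

/-- The colors at the crossings after a third Reidemeister move are determined by the colors `t`, `m`,
`l` in the middle of the three strands. -/
theorem exists_through {X : Type} (f g : Bool → X × X → X) (α β γ x y z : Bool)
    {t₀ t₁ m₀ m₁ l₀ l₁ : X}
    (h : ∃ t m : X,
      (fun p : X × X => g x p = (if α then t₁ else t) ∧ f x p = (if β then m₁ else m))
        (if β then m else m₀, if α then t else t₀) ∧
      ∃ l : X,
        (fun q : X × X => g y q = (if α then t else t₁) ∧ f y q = (if γ then l₁ else l))
          (if γ then l else l₀, if α then t₀ else t) ∧
        (fun r : X × X => g z r = (if β then m else m₁) ∧ f z r = (if γ then l else l₁))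
          (if γ then l₀ else l, if β then m₀ else m)) :
    ∃ p q r : X × X,
      Through (!α) (p.2, g x p) (q.2, g y q) t₀ t₁ ∧
      Through (!β) (p.1, f x p) (r.2, g z r) m₀ m₁ ∧
      Through (!γ) (q.1, f y q) (r.1, f z r) l₀ l₁ := by
  obtain ⟨t, m, hp, l, hq, hr⟩ := h
  refine ⟨(if β then m else m₀, if α then t else t₀), (if γ then l else l₀, if α then t₀ else t),
    (if γ then l₀ else l, if β then m₀ else m), ?_, ?_, ?_⟩
  · cases α <;> simp [Through] at hp hq ⊢ <;> simp [hp, hq]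
  · cases β <;> simp [Through] at hp hr ⊢ <;> simp [hp, hr]
  · cases γ <;> simp [Through] at hq hr ⊢ <;> simp [hq, hr]

/-- A form of the third Reidemeister axiom that can be decided quickly. -/
theorem r3_exists_of_forall {X : Type} (f g : Bool → X × X → X)
    (h : ∀ (ε x y z : Bool) (p q : X × X),
      (if ε == (x == (y == z)) then g x p = q.2 else g y q = p.2) → ∀ r : X × X,
      (if ε == x then f x p = r.2 else g z r = p.1) →
      (if ε == y then f y q = r.1 else f z r = q.1) →
      (fun (α β γ : Bool) (t₀ t₁ m₀ m₁ l₀ l₁ : X) => ∃ t m : X,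
        (fun p : X × X => g x p = (if α then t₁ else t) ∧ f x p = (if β then m₁ else m))
          (if β then m else m₀, if α then t else t₀) ∧
        ∃ l : X,
          (fun q : X × X => g y q = (if α then t else t₁) ∧ f y q = (if γ then l₁ else l))
            (if γ then l else l₀, if α then t₀ else t) ∧
          (fun r : X × X => g z r = (if β then m else m₁) ∧ f z r = (if γ then l else l₁))
            (if γ then l₀ else l, if β then m₀ else m))
        (ε == (x == (y == z))) (ε == x) (ε == y)
        (if ε == (x == (y == z)) then p.2 else q.2)
        (if ε == (x == (y == z)) then g y q else g x p)
        (if ε == x then p.1 else r.2) (if ε == x then g z r else f x p)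
        (if ε == y then q.1 else r.1) (if ε == y then f z r else f y q))
    (ε x y z : Bool) (p q r : X × X) (t t' m m' l l' : X)
    (h1 : Through (ε == (x == (y == z))) (p.2, g x p) (q.2, g y q) t t')
    (h2 : Through (ε == x) (p.1, f x p) (r.2, g z r) m m')
    (h3 : Through (ε == y) (q.1, f y q) (r.1, f z r) l l') :
    ∃ p q r : X × X,
      Through (!(ε == (x == (y == z)))) (p.2, g x p) (q.2, g y q) t t' ∧
      Through (!(ε == x)) (p.1, f x p) (r.2, g z r) m m' ∧
      Through (!(ε == y)) (q.1, f y q) (r.1, f z r) l l' := by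
  apply exists_through
  have h := h ε x y z p q
  generalize (ε == (x == (y == z))) = α at *
  generalize (ε == x) = β at *
  generalize (ε == y) = γ at *
  -- A strand condition amounts to a match of colors on the middle arc together with formulas for
  -- the two end colors. Eliminating the ends leaves only `p`, `q`, `r` to range over.
  have k1 : (if α then g x p = q.2 else g y q = p.2) ∧ (if α then p.2 else q.2) = t ∧
      (if α then g y q else g x p) = t' := by
    cases α
    · exact ⟨h1.2.1, h1.1.symm, h1.2.2⟩
    · exact ⟨h1.2.1, h1.1.symm, h1.2.2⟩
  have k2 : (if β then f x p = r.2 else g z r = p.1) ∧ (if β then p.1 else r.2) = m ∧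
      (if β then g z r else f x p) = m' := by
    cases β
    · exact ⟨h2.2.1, h2.1.symm, h2.2.2⟩
    · exact ⟨h2.2.1, h2.1.symm, h2.2.2⟩
  have k3 : (if γ then f y q = r.1 else f z r = q.1) ∧ (if γ then q.1 else r.1) = l ∧
      (if γ then f z r else f y q) = l' := by
    cases γ
    · exact ⟨h3.2.1, h3.1.symm, h3.2.2⟩
    · exact ⟨h3.2.1, h3.1.symm, h3.2.2⟩
  have h := h k1.1 r k2.1 k3.1
  rw [k1.2.1, k1.2.2, k2.2.1, k2.2.2, k3.2.1, k3.2.2] at h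
  exact h

/-- The biquandle of Fox 3-colorings. -/
def foxBiquandle : Biquandle (ZMod 3) where
  -- Modulo 3 this is `2 * over - under`: the three colors at a crossing sum to zero.
  underColor _ p := -p.1 - p.2
  overColor _ p := p.2
  ext_in _ p q h h' := by
    refine Prod.ext ?_ h'
    rw [h'] at h
    simpa using h
  ext_out _ p q h h' := Prod.ext h' h
  ext_both _ p q h h' := by
    refine Prod.ext ?_ h'
    rw [h'] at h
    simpa using h
  r1_over_exists := by decide
  r1_over_unique := by decide
  r1_under_exists := by decide
  r1_under_unique := by decide
  r2_exists := by
    intro _ d x y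
    refine ⟨(if d then y else -y - x, x), (if d then -y - x else y, x), ?_, ?_⟩
    · simp [Through]
    · cases d <;> simp [Through]
  r2_ends := by
    rintro _ d ⟨p, p'⟩ ⟨q, q'⟩ x x' y y' ⟨rfl, rfl, rfl⟩ h
    refine ⟨rfl, ?_⟩
    cases d
    · obtain ⟨rfl, h, rfl⟩ := h
      simp only at h ⊢
      simp [← h]
    · obtain ⟨rfl, h, rfl⟩ := h
      simp only at h ⊢
      simp [← h]
  r3_exists := r3_exists_of_forall _ _ (by decide +kernel)

/-- The outgoing under-color of the biquandle `kishinoBiquandle`. -/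
def kishinoUnder : Bool → (Bool × Bool) × (Bool × Bool) → Bool × Bool
  | true, ((a, b), (c, d)) => (a ^^ d, b ^^ (a ^^ (c ^^ d)))
  | false, ((a, b), (c, d)) => (b ^^ (c ^^ d), a ^^ c)

/-- The outgoing over-color of the biquandle `kishinoBiquandle`. -/
def kishinoOver : Bool → (Bool × Bool) × (Bool × Bool) → Bool × Bool
  | true, ((a, b), (c, d)) => (a ^^ (b ^^ d), a ^^ c)
  | false, ((a, b), (c, d)) => (b ^^ c, a ^^ (b ^^ (c ^^ d)))

set_option synthInstance.maxHeartbeats 400000 in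
set_option synthInstance.maxSize 1000 in
/-- A biquandle with four elements, linear over the field with two elements. -/
def kishinoBiquandle : Biquandle (Bool × Bool) where
  underColor := kishinoUnder
  overColor := kishinoOver
  ext_in := by decide +kernel
  ext_out := by decide +kernel
  ext_both := by decide +kernel
  r1_over_exists := by decide +kernel
  r1_over_unique := by decide +kernel
  r1_under_exists := by decide +kernel
  r1_under_unique := by decide +kernel
  r2_exists := by decide +kernel
  r2_ends := by
    intro s d p q x x' y y' h h'
    -- The end colors are functions of `p` and `q`, so a finite check over these two pairs suffices.
    have key : ∀ (s d : Bool) (p q : (Bool × Bool) × (Bool × Bool)), kishinoOver s p = q.2 →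
        (if d then kishinoUnder s p = q.1 else kishinoUnder (!s) q = p.1) →
        p.2 = kishinoOver (!s) q ∧
          (if d then p.1 = kishinoUnder (!s) q else q.1 = kishinoUnder s p) := by decide +kernel
    obtain ⟨rfl, h2, rfl⟩ := h
    cases d
    · obtain ⟨rfl, h2', rfl⟩ := h'
      exact key s false p q h2 h2'
    · obtain ⟨rfl, h2', rfl⟩ := h'
      exact key s true p q h2 h2'
  r3_exists := r3_exists_of_forall _ _ (by decide +kernel)

/-! ### The words `sumCode n r` -/

theorem label_mem_relabel {f : ℕ → ℕ} {w : List Letter} {a : ℕ} :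
    a ∈ labels (relabel f w) ↔ ∃ b ∈ labels w, f b = a := by
  simp [labels, relabel]

theorem IsGaussCode.relabel {f : ℕ → ℕ} (hf : f.Injective) {w : List Letter}
    (h : IsGaussCode w) : IsGaussCode (relabel f w) := by
  refine ⟨?_, fun e he => ?_⟩
  · have : ((VirtualBridge.relabel f w).map fun e => (e.label, e.isOver)) =
        (w.map fun e => (e.label, e.isOver)).map (Prod.map f id) := by
      simp [VirtualBridge.relabel, Function.comp_def]
    rw [this]
    exact h.1.map (hf.prodMap Function.injective_id)
  · obtain ⟨e', he', rfl⟩ := List.mem_map.1 he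
    exact List.mem_map.2 ⟨_, h.2 e' he', rfl⟩

theorem IsGaussCode.append {u v : List Letter} (hu : IsGaussCode u) (hv : IsGaussCode v)
    (h : ∀ a ∈ labels u, a ∉ labels v) : IsGaussCode (u ++ v) := by
  refine ⟨?_, fun e he => ?_⟩
  · rw [List.map_append]
    refine List.nodup_append.2 ⟨hu.1, hv.1, ?_⟩
    rintro p hp _ hq rfl
    obtain ⟨e, he, rfl⟩ := List.mem_map.1 hp
    obtain ⟨f, hf, hef⟩ := List.mem_map.1 hq
    exact h _ (label_mem_labels he) ((Prod.mk.inj hef).1 ▸ label_mem_labels hf)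
  · rcases List.mem_append.1 he with he | he
    · exact List.mem_append_left _ (hu.2 e he)
    · exact List.mem_append_right _ (hv.2 e he)

theorem isGaussCode_bowTie : IsGaussCode bowTie := by
  simp [IsGaussCode, bowTie, Letter.partner]

theorem isGaussCode_trefoil : IsGaussCode trefoil := by
  simp [IsGaussCode, trefoil, Letter.partner]

theorem shift_eq_relabel (k : ℕ) (w : List Letter) : shift k w = relabel (· + k) w := rfl

theorem lt_of_mem_labels_shift {k l : ℕ} {w : List Letter} (hw : ∀ a ∈ labels w, a < l) {a : ℕ}
    (ha : a ∈ labels (shift k w)) : k ≤ a ∧ a < k + l := by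
  rw [shift_eq_relabel, label_mem_relabel] at ha
  obtain ⟨b, hb, rfl⟩ := ha
  have := hw b hb
  omega

theorem labels_bowTie_lt : ∀ a ∈ labels bowTie, a < 4 := by
  simp [labels, bowTie]

theorem labels_trefoil_lt : ∀ a ∈ labels trefoil, a < 3 := by
  simp [labels, trefoil]

/-- The labels of the first `n` of a sequence of words that use consecutive blocks of labels. -/
theorem lt_of_mem_labels_flatMap {g : ℕ → List Letter} {k l : ℕ}
    (hg : ∀ i, ∀ a ∈ labels (g i), k + l * i ≤ a ∧ a < k + l * i + l) {n a : ℕ}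
    (ha : a ∈ labels ((List.range n).flatMap g)) : k ≤ a ∧ a < k + l * n := by
  obtain ⟨e, he, rfl⟩ := List.mem_map.1 ha
  obtain ⟨i, hi, he⟩ := List.mem_flatMap.1 he
  have h := hg i _ (label_mem_labels he)
  have : l * i + l ≤ l * n := by
    rw [← Nat.mul_succ]
    exact Nat.mul_le_mul_left l (List.mem_range.1 hi)
  omega

theorem flatMap_range_succ (g : ℕ → List Letter) (n : ℕ) :
    (List.range (n + 1)).flatMap g = (List.range n).flatMap g ++ g n := by
  simp [List.range_succ]

theorem isGaussCode_flatMap {g : ℕ → List Letter} {k l : ℕ}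
    (hg : ∀ i, ∀ a ∈ labels (g i), k + l * i ≤ a ∧ a < k + l * i + l)
    (h : ∀ i, IsGaussCode (g i)) (n : ℕ) : IsGaussCode ((List.range n).flatMap g) := by
  induction n with
  | zero => simp [IsGaussCode]
  | succ n ih =>
    rw [flatMap_range_succ]
    refine ih.append (h n) fun a ha ha' => ?_
    have h1 := lt_of_mem_labels_flatMap hg ha
    have h2 := hg n a ha'
    omega

theorem isGaussCode_shift (k : ℕ) {w : List Letter} (h : IsGaussCode w) :
    IsGaussCode (shift k w) :=
  h.relabel (add_left_injective k)

theorem labels_shift_bowTie (i : ℕ) : ∀ a ∈ labels (shift (4 * i) bowTie),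
    0 + 4 * i ≤ a ∧ a < 0 + 4 * i + 4 := fun a ha => by
  have := lt_of_mem_labels_shift labels_bowTie_lt ha
  omega

theorem labels_shift_trefoil (n j : ℕ) : ∀ a ∈ labels (shift (4 * n + 3 * j) trefoil),
    4 * n + 3 * j ≤ a ∧ a < 4 * n + 3 * j + 3 := fun a ha => by
  have := lt_of_mem_labels_shift labels_trefoil_lt ha
  omega

theorem sumCode_disjoint {n r a : ℕ}
    (ha : a ∈ labels ((List.range n).flatMap fun i => shift (4 * i) bowTie))
    (hb : a ∈ labels ((List.range r).flatMap fun j => shift (4 * n + 3 * j) trefoil)) : False := by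
  have h1 := lt_of_mem_labels_flatMap labels_shift_bowTie ha
  have h2 := lt_of_mem_labels_flatMap (labels_shift_trefoil n) hb
  omega

theorem isGaussCode_sumCode (n r : ℕ) : IsGaussCode (sumCode n r) :=
  (isGaussCode_flatMap labels_shift_bowTie (fun _ => isGaussCode_shift _ isGaussCode_bowTie)
    n).append (isGaussCode_flatMap (labels_shift_trefoil n)
      (fun _ => isGaussCode_shift _ isGaussCode_trefoil) r) fun _ ha hb => sumCode_disjoint ha hb

/-! ### Colorings of the words `sumCode n r` -/

section

open Cardinal

variable {X : Type} {B : Biquandle X} [Inhabited X]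

/-- Colorings of the two words can be chosen independently: they share no crossing and all their
ends have the color `s`. -/
theorem mk_longColoring_append_le {u v : List Letter} (h : ∀ a ∈ labels u, a ∉ labels v) (s : X) :
    #(LongColoring B u s) * #(LongColoring B v s) ≤ #(LongColoring B (u ++ v) s) := by
  classical
  rw [mul_def]
  have key : ∀ p : LongColoring B u s × LongColoring B v s, ∃ q : LongColoring B (u ++ v) s,
      (∀ a ∈ labels u, q.1 a = p.1.1 a) ∧ ∀ a ∈ labels v, q.1 a = p.2.1 a := by
    rintro ⟨⟨κ, hκ, hd⟩, κ', hκ', hd'⟩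
    have h1 : ∀ a ∈ labels u, (if a ∈ labels u then κ a else κ' a) = κ a := fun a ha => if_pos ha
    have h2 : ∀ a ∈ labels v, (if a ∈ labels u then κ a else κ' a) = κ' a := fun a ha =>
      if_neg fun hu => h a hu ha
    refine ⟨⟨fun a => if a ∈ labels u then κ a else κ' a, ?_, fun a ha => ?_⟩, h1, h2⟩
    · refine fits_append.2 ⟨s, ?_, ?_⟩
      · exact (fits_congr fun e he => h1 _ (label_mem_labels he)).2 hκ
      · exact (fits_congr fun e he => h2 _ (label_mem_labels he)).2 hκ'
    · rw [labels_append, not_or] at ha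
      refine (if_neg ha.1).trans ?_
      exact hd' a ha.2
  choose F h1 h2 using key
  refine mk_le_of_injective (f := F) fun p p' hpp => Prod.ext ?_ ?_
  · refine Subtype.ext (funext fun a => ?_)
    by_cases ha : a ∈ labels u
    · rw [← h1 p a ha, ← h1 p' a ha, hpp]
    · rw [p.1.2.2 a ha, p'.1.2.2 a ha]
  · refine Subtype.ext (funext fun a => ?_)
    by_cases ha : a ∈ labels v
    · rw [← h2 p a ha, ← h2 p' a ha, hpp]
    · rw [p.2.2.2 a ha, p'.2.2.2 a ha]

theorem pow_le_mk_longColoring_flatMap {g : ℕ → List Letter} {k l : ℕ}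
    (hg : ∀ i, ∀ a ∈ labels (g i), k + l * i ≤ a ∧ a < k + l * i + l) {c : Cardinal} {s : X}
    (h : ∀ i, c ≤ #(LongColoring B (g i) s)) (n : ℕ) :
    c ^ n ≤ #(LongColoring B ((List.range n).flatMap g) s) := by
  induction n with
  | zero =>
    rw [pow_zero, Cardinal.one_le_iff_ne_zero, mk_ne_zero_iff]
    exact ⟨⟨fun _ => default, rfl, fun _ _ => rfl⟩⟩
  | succ n ih =>
    rw [flatMap_range_succ, pow_succ]
    refine (mul_le_mul' ih (h n)).trans (mk_longColoring_append_le (fun a ha ha' => ?_) s)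
    have h1 := lt_of_mem_labels_flatMap hg ha
    have h2 := hg n a ha'
    omega

theorem mul_pow_le_mk_longColoring_sumCode {b c : Cardinal} {s : X}
    (hb : b ≤ #(LongColoring B bowTie s)) (hc : c ≤ #(LongColoring B trefoil s)) (n r : ℕ) :
    b ^ n * c ^ r ≤ #(LongColoring B (sumCode n r) s) := by
  have hs : ∀ (k : ℕ) (w : List Letter), #(LongColoring B w s) ≤ #(LongColoring B (shift k w) s) :=
    fun k w => mk_longColoring_relabel_le (add_left_injective k) w s
  exact (mul_le_mul'
    (pow_le_mk_longColoring_flatMap labels_shift_bowTie (fun i => hb.trans (hs _ _)) n)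
    (pow_le_mk_longColoring_flatMap (labels_shift_trefoil n) (fun i => hc.trans (hs _ _)) r)).trans
      (mk_longColoring_append_le (fun _ ha hb => sumCode_disjoint ha hb) s)

/-- The constant coloring works, since `-s - s = s` modulo 3. -/
theorem one_le_mk_longColoring_bowTie (s : ZMod 3) :
    1 ≤ #(LongColoring foxBiquandle bowTie s) := by
  rw [Cardinal.one_le_iff_ne_zero, mk_ne_zero_iff]
  refine ⟨⟨fun a => if a < 4 then (s, s) else default, ?_, fun a ha => if_neg fun h => ha ?_⟩⟩
  · revert s
    simp only [Fits, bowTie, inColor, outColor, foxBiquandle]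
    decide
  · interval_cases a <;> simp [labels, bowTie]

theorem three_le_mk_longColoring_trefoil (s : ZMod 3) :
    3 ≤ #(LongColoring foxBiquandle trefoil s) := by
  have key : ∀ c : ZMod 3, ∃ κ : LongColoring foxBiquandle trefoil s, (κ.1 1).2 = c := by
    intro c
    -- The arcs have the colors `s`, `-s - c`, `c` and again `s`; the color `c` is free even though
    -- both ends are fixed.
    refine ⟨⟨fun a => if a = 0 then (-s - c, s) else if a = 1 then (s, c) else
      if a = 2 then (c, -s - c) else default, ?_, fun a ha => ?_⟩, rfl⟩
    · revert s c
      simp only [Fits, trefoil, inColor, outColor, foxBiquandle]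
      decide
    · simp only [labels, trefoil, List.map_cons, List.mem_cons, not_or] at ha
      simp [ha]
  choose F hF using key
  calc (3 : Cardinal) = #(ZMod 3) := by simp [ZMod]
    _ ≤ _ := mk_le_of_injective (f := F) fun c d h => by rw [← hF c, ← hF d, h]

theorem one_le_mk_longColoring_trefoil :
    1 ≤ #(LongColoring kishinoBiquandle trefoil default) := by
  rw [Cardinal.one_le_iff_ne_zero, mk_ne_zero_iff]
  refine ⟨⟨fun a => default, ?_, fun a ha => rfl⟩⟩
  simp only [Fits, trefoil, inColor, outColor, kishinoBiquandle]
  decide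

theorem four_le_mk_longColoring_bowTie :
    4 ≤ #(LongColoring kishinoBiquandle bowTie default) := by
  have key : ∀ a b : Bool, ∃ κ : LongColoring kishinoBiquandle bowTie default,
      κ.1 0 = ((a, a), default) ∧ (κ.1 2).1 = (b, false) := by
    intro a b
    -- With zero at both ends the coloring conditions are linear over the field with two elements;
    -- `a` and `b` parametrize a plane of solutions.
    refine ⟨⟨fun c => if c = 0 then ((a, a), default) else if c = 1 then ((false, a), (a, false))
      else if c = 2 then ((b, false), (a, a)) else
      if c = 3 then ((a ^^ b, b), (a ^^ b, a ^^ b)) else default, ?_, fun c hc => ?_⟩, rfl, rfl⟩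
    · revert a b
      simp only [Fits, bowTie, inColor, outColor, kishinoBiquandle]
      decide
    · simp only [labels, bowTie, List.map_cons, List.mem_cons, not_or] at hc
      simp [hc]
  choose F h1 h2 using key
  calc (4 : Cardinal) = #(Bool × Bool) := by simp
    _ ≤ _ := mk_le_of_injective (f := fun p : Bool × Bool => F p.1 p.2) fun p q h => by
      have e1 := h1 p.1 p.2
      have e2 := h2 p.1 p.2
      simp only at h
      rw [h, h1] at e1
      rw [h, h2] at e2
      simp only [Prod.mk.injEq] at e1 e2
      exact Prod.ext e1.1.1.symm e2.1.symm

theorem four_pow_le_mk_coloring_sumCode (n r : ℕ) :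
    4 ^ n ≤ #(Coloring kishinoBiquandle (sumCode n r)) := by
  have h := mul_pow_le_mk_longColoring_sumCode four_le_mk_longColoring_bowTie
    one_le_mk_longColoring_trefoil n r
  rw [one_pow, mul_one] at h
  rw [mk_coloring]
  exact h.trans (le_sum _ _)

/-- Each of the three base colors `s` contributes `3 ^ r` colorings, whence the exponent `r + 1`. -/
theorem three_pow_le_mk_coloring_sumCode (n r : ℕ) :
    3 ^ (r + 1) ≤ #(Coloring foxBiquandle (sumCode n r)) := by
  have h : ∀ s, 3 ^ r ≤ #(LongColoring foxBiquandle (sumCode n r) s) := fun s => by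
    have h := mul_pow_le_mk_longColoring_sumCode (one_le_mk_longColoring_bowTie s)
      (three_le_mk_longColoring_trefoil s) n r
    rwa [one_pow, one_mul] at h
  rw [mk_coloring]
  calc (3 : Cardinal) ^ (r + 1) = Cardinal.sum fun _ : ZMod 3 => (3 : Cardinal) ^ r := by
        rw [sum_const', pow_succ']
        simp [ZMod]
    _ ≤ _ := sum_le_sum _ _ h

end

/-! ### Fox colorings bound the number of overbridges -/

/-- The number of passages of a long word from under-letters to over-letters; `p` tells whether the
letter before the word is an over-letter. -/
def ascents (p : Bool) : List Letter → ℕ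
  | [] => 0
  | e :: w => (if !p && e.isOver then 1 else 0) + ascents e.isOver w

/-- Whether the last letter of the word is an over-letter; `p` if there is none. -/
def lastOver (p : Bool) : List Letter → Bool
  | [] => p
  | e :: w => lastOver e.isOver w

theorem ascents_append (p : Bool) (u v : List Letter) :
    ascents p (u ++ v) = ascents p u + ascents (lastOver p u) v := by
  induction u generalizing p with
  | nil => simp [ascents, lastOver]
  | cons e u ih => simp [ascents, lastOver, ih, add_assoc]

theorem lastOver_append (p : Bool) (u v : List Letter) :
    lastOver p (u ++ v) = lastOver (lastOver p u) v := by
  induction u generalizing p with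
  | nil => rfl
  | cons e u ih => exact ih _

theorem countP_zip_append (e f : Letter) (w : List Letter) :
    ((e :: w).zip (w ++ [f])).countP (fun p => !p.1.isOver && p.2.isOver) =
      ascents e.isOver (w ++ [f]) := by
  induction w generalizing e with
  | nil => simp [ascents, List.countP_cons]
  | cons g w ih =>
    rw [List.cons_append, List.zip_cons_cons, List.countP_cons, ih]
    simp [ascents, add_comm]

theorem overbridges_eq_ascents {w : List Letter} (hw : w ≠ []) (p : Bool) :
    overbridges w = ascents (lastOver p w) w := by
  obtain ⟨e, w, rfl⟩ := List.exists_cons_of_ne_nil hw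
  have h := countP_zip_append e e w
  simp only [overbridges, List.isEmpty_cons, List.rotate_cons_succ, List.rotate_zero]
  rw [if_neg (by simp), h, ascents_append]
  simp [ascents, lastOver, add_comm]

/-- The colors of the over-letters that follow under-letters. -/
def bridgeColors {X : Type} (κ : ℕ → X × X) (p : Bool) : List Letter → List X
  | [] => []
  | e :: w => (if !p && e.isOver then [(κ e.label).2] else []) ++ bridgeColors κ e.isOver w

theorem length_bridgeColors {X : Type} (κ : ℕ → X × X) (p : Bool) (w : List Letter) :
    (bridgeColors κ p w).length = ascents p w := by
  induction w generalizing p with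
  | nil => rfl
  | cons e w ih =>
    simp only [bridgeColors, ascents, List.length_append, ih]
    split_ifs <;> rfl

/-- Over-passages do not change a Fox color, so the color recorded at the start of a bridge spreads
to all its over-letters. If the word starts inside a bridge (`p = true`), the start color plays this
role. -/
theorem overColor_eq_of_bridgeColors_eq {κ κ' : ℕ → ZMod 3 × ZMod 3} {p : Bool}
    {w : List Letter} {s s' t t' : ZMod 3} (h : Fits foxBiquandle κ w s t)
    (h' : Fits foxBiquandle κ' w s' t') (hb : bridgeColors κ p w = bridgeColors κ' p w)
    (hs : p = true → s = s') : ∀ e ∈ w, e.isOver = true → (κ e.label).2 = (κ' e.label).2 := by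
  induction w generalizing p s s' with
  | nil => simp
  | cons e w ih =>
    obtain ⟨rfl, h⟩ := h
    obtain ⟨rfl, h'⟩ := h'
    rcases he : e.isOver with _ | _
    · have hb' : bridgeColors κ e.isOver w = bridgeColors κ' e.isOver w := by
        simpa [bridgeColors, he] using hb
      have := ih h h' hb' (by simp [he])
      simpa [he] using this
    · have hb' : (κ e.label).2 = (κ' e.label).2 ∧
          bridgeColors κ e.isOver w = bridgeColors κ' e.isOver w := by
        cases p
        · simpa [bridgeColors, he] using hb
        · exact ⟨by simpa [inColor, he] using hs rfl, by simpa [bridgeColors, he] using hb⟩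
      have := ih h h' hb'.2 fun _ => by simpa [outColor, he, foxBiquandle] using hb'.1
      simpa [hb'.1] using this

/-- From the first over-letter, walk back to the start: at an under-letter the outgoing color and
the over-color determine the incoming color. -/
theorem start_eq_of_overColor_eq {κ κ' : ℕ → ZMod 3 × ZMod 3}
    {w : List Letter} {s s' t t' : ZMod 3} (h : Fits foxBiquandle κ w s t)
    (h' : Fits foxBiquandle κ' w s' t')
    (ho : ∀ e ∈ w, (κ e.label).2 = (κ' e.label).2) (he : ∃ e ∈ w, e.isOver = true) : s = s' := by
  induction w generalizing s s' with
  | nil => simp at he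
  | cons e w ih =>
    obtain ⟨rfl, h⟩ := h
    obtain ⟨rfl, h'⟩ := h'
    have hoe := ho e (by simp)
    rcases heo : e.isOver with _ | _
    · have := ih h h' (fun f hf => ho f (by simp [hf])) (by simpa [heo] using he)
      simpa [outColor, inColor, heo, foxBiquandle, hoe] using this
    · simpa [inColor, heo] using hoe

theorem underColor_eq_of_overColor_eq {κ κ' : ℕ → ZMod 3 × ZMod 3}
    {w : List Letter} {s t t' : ZMod 3} (h : Fits foxBiquandle κ w s t)
    (h' : Fits foxBiquandle κ' w s t') (ho : ∀ e ∈ w, (κ e.label).2 = (κ' e.label).2) :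
    ∀ e ∈ w, e.isOver = false → (κ e.label).1 = (κ' e.label).1 := by
  induction w generalizing s with
  | nil => simp
  | cons e w ih =>
    obtain ⟨hs, h⟩ := h
    obtain ⟨hs', h'⟩ := h'
    have hoe := ho e (by simp)
    have heq : inColor κ e = inColor κ' e := hs.symm.trans hs'
    have hout : outColor foxBiquandle κ e = outColor foxBiquandle κ' e := by
      rcases heo : e.isOver with _ | _
      · simp only [inColor, heo, Bool.false_eq_true, if_false] at heq
        simp [outColor, heo, foxBiquandle, hoe, heq]
      · simp [outColor, heo, foxBiquandle, hoe]
    rw [hout] at h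
    have := ih h h' fun f hf => ho f (by simp [hf])
    intro f hf hfo
    rcases List.mem_cons.1 hf with rfl | hf
    · simpa [inColor, hfo] using heq
    · exact this f hf hfo

theorem IsGaussCode.exists_isOver {w : List Letter} (h : IsGaussCode w) {e : Letter}
    (he : e ∈ w) (o : Bool) : ∃ f ∈ w, f.label = e.label ∧ f.isOver = o := by
  by_cases ho : e.isOver = o
  · exact ⟨e, he, rfl, ho⟩
  · refine ⟨_, h.2 e he, rfl, ?_⟩
    revert ho
    cases o <;> simp [Letter.partner]

open Cardinal

/-- The bridge colors determine the colors at all over-letters, these determine the base color, and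
a walk along the word then gives the colors at the under-letters. -/
theorem mk_coloring_le_pow_ascents {w : List Letter} (h : IsGaussCode w) (hw : w ≠ []) :
    #(Coloring foxBiquandle w) ≤ 3 ^ ascents false w := by
  have key : ∀ p : Coloring foxBiquandle w, ∃ l : List.Vector (ZMod 3) (ascents false w),
      l.1 = bridgeColors p.2.1 false w := fun p => ⟨⟨_, length_bridgeColors _ _ _⟩, rfl⟩
  choose F hF using key
  have hcard : #(List.Vector (ZMod 3) (ascents false w)) = 3 ^ ascents false w := by
    rw [mk_vector]
    simp [ZMod]
  rw [← hcard]
  refine mk_le_of_injective (f := F) fun p p' hpp => ?_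
  have hb : bridgeColors p.2.1 false w = bridgeColors p'.2.1 false w := by rw [← hF, ← hF, hpp]
  obtain ⟨s, κ, hκ, hd⟩ := p
  obtain ⟨s', κ', hκ', hd'⟩ := p'
  simp only at hb
  have ho := overColor_eq_of_bridgeColors_eq hκ hκ' hb (by simp)
  have ho' : ∀ e ∈ w, (κ e.label).2 = (κ' e.label).2 := by
    intro e he
    obtain ⟨f, hf, hfe, hfo⟩ := h.exists_isOver he true
    rw [← hfe]
    exact ho f hf hfo
  obtain ⟨e, he⟩ := List.exists_mem_of_ne_nil w hw
  obtain ⟨f, hf, -, hfo⟩ := h.exists_isOver he true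
  obtain rfl := start_eq_of_overColor_eq hκ hκ' ho' ⟨f, hf, hfo⟩
  have hu := underColor_eq_of_overColor_eq hκ hκ' ho'
  have : κ = κ' := by
    funext a
    by_cases ha : a ∈ labels w
    · obtain ⟨e, he, rfl⟩ := List.mem_map.1 ha
      obtain ⟨f, hf, hfe, hfo⟩ := h.exists_isOver he false
      refine Prod.ext ?_ (ho' e he)
      rw [← hfe]
      exact hu f hf hfo
    · rw [hd a ha, hd' a ha]
  subst this
  rfl

theorem overbridges_append_comm (u v : List Letter) :
    overbridges (u ++ v) = overbridges (v ++ u) := by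
  rcases u with _ | ⟨e, u⟩
  · simp
  rcases v with _ | ⟨f, v⟩
  · simp
  rw [overbridges_eq_ascents (by simp) false, overbridges_eq_ascents (by simp) false]
  simp only [lastOver_append, ascents_append, lastOver]
  rw [add_comm]

theorem mk_coloring_le_pow_overbridges {w : List Letter} (h : IsGaussCode w) :
    #(Coloring foxBiquandle w) ≤ 3 ^ overbridges w := by
  rcases eq_or_ne w [] with rfl | hw
  -- The empty word has only a base color, in agreement with its one conventional bridge.
  · have : #(Coloring foxBiquandle []) ≤ #(ZMod 3) := by
      refine mk_le_of_injective (f := Sigma.fst) ?_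
      rintro ⟨s, κ, hκ, hd⟩ ⟨s', κ', hκ', hd'⟩ rfl
      have : κ = κ' := by
        funext a
        rw [hd a (by simp [labels]), hd' a (by simp [labels])]
      subst this
      rfl
    simpa [overbridges, ZMod] using this
  · obtain ⟨e, he⟩ := List.exists_mem_of_ne_nil w hw
    obtain ⟨f, hf, -, hfo⟩ := h.exists_isOver he false
    obtain ⟨u, v, rfl⟩ := List.append_of_mem hf
    -- Rotate the word so that it ends with the under-letter `f`; then `ascents false` is the cyclic
    -- count.
    have e1 : u ++ f :: v = (u ++ [f]) ++ v := by simp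
    rw [e1] at h ⊢
    have hp := List.perm_append_comm (l₁ := u ++ [f]) (l₂ := v)
    have h' := (isGaussCode_perm hp).1 h
    rw [overbridges_append_comm, h.mk_coloring_eq h' (Move.rotate _ _),
      overbridges_eq_ascents (by simp) false]
    have hl : lastOver false (v ++ (u ++ [f])) = false := by simp [lastOver_append, lastOver, hfo]
    rw [hl]
    exact mk_coloring_le_pow_ascents h' (by simp)

theorem le_overbridges_of_isRepresentedBy {K : VirtualKnot} {n r : ℕ} {w : List Letter}
    (hK : K.IsRepresentedBy (sumCode n r)) (hw : K.IsRepresentedBy w) :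
    r + 1 ≤ overbridges w := by
  have h := (three_pow_le_mk_coloring_sumCode n r).trans
    ((mk_coloring_eq_of_isRepresentedBy hK hw).trans_le
      (mk_coloring_le_pow_overbridges hw.choose))
  have h' : (3 : ℕ) ^ (r + 1) ≤ 3 ^ overbridges w := by exact_mod_cast h
  exact (Nat.pow_le_pow_iff_right (by norm_num)).1 h'

/-! ### Colorings bound the number of local maxima -/

/-- Two common points met in the same order put both segments on one line with the same direction.
Going back from `P`, the starting point that is reached first lies on the other segment. -/
theorem mem_segment_or_mem_segment_of_lt {A B C E P P' : ℝ × ℝ} {s s' u u' : ℝ}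
    (hs : 0 ≤ s) (hs' : s ≤ 1) (hu : 0 ≤ u) (hu' : u ≤ 1) (hlt : s < s') (hlt' : u < u')
    (h1 : A + s • (B - A) = P) (h2 : A + s' • (B - A) = P') (h3 : C + u • (E - C) = P)
    (h4 : C + u' • (E - C) = P') : C ∈ segment ℝ A B ∨ A ∈ segment ℝ C E := by
  have hss : 0 < s' - s := sub_pos.2 hlt
  have huu : 0 < u' - u := sub_pos.2 hlt'
  have hdir : (s' - s) • (B - A) = (u' - u) • (E - C) := by
    have : P' - P = (s' - s) • (B - A) := by rw [← h1, ← h2]; module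
    rw [← this, ← h3, ← h4]; module
  have hB : B - A = ((u' - u) / (s' - s)) • (E - C) := by
    rw [div_eq_inv_mul, mul_smul, ← hdir, smul_smul, inv_mul_cancel₀ hss.ne', one_smul]
  have hE : E - C = ((s' - s) / (u' - u)) • (B - A) := by
    rw [div_eq_inv_mul, mul_smul, hdir, smul_smul, inv_mul_cancel₀ huu.ne', one_smul]
  rw [segment_eq_image', segment_eq_image']
  rcases le_total (u * ((s' - s) / (u' - u))) s with h | h
  · refine .inl ⟨s - u * ((s' - s) / (u' - u)), ⟨by linarith, ?_⟩, ?_⟩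
    · have : 0 ≤ u * ((s' - s) / (u' - u)) := by positivity
      linarith
    · have : C = P - u • (E - C) := by rw [← h3]; module
      rw [this, hE, ← h1]
      module
  · refine .inr ⟨u - s * ((u' - u) / (s' - s)), ⟨?_, ?_⟩, ?_⟩
    · have h5 : s * ((u' - u) / (s' - s)) ≤
          u * ((s' - s) / (u' - u)) * ((u' - u) / (s' - s)) := by gcongr
      have h6 : u * ((s' - s) / (u' - u)) * ((u' - u) / (s' - s)) = u := by field_simp
      linarith
    · have : 0 ≤ s * ((u' - u) / (s' - s)) := by positivity
      linarith
    · have : A = P - s • (B - A) := by rw [← h1]; module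
      rw [this, hB, ← h3]
      module

/-- Two segments, neither of which contains an end point of the other, meet in at most one point. -/
theorem eq_of_mem_segment_inter {A B C E P P' : ℝ × ℝ} (hP : P ∈ segment ℝ A B)
    (hP' : P' ∈ segment ℝ A B) (hQ : P ∈ segment ℝ C E) (hQ' : P' ∈ segment ℝ C E)
    (hA : A ∉ segment ℝ C E) (hC : C ∉ segment ℝ A B) (hE : E ∉ segment ℝ A B) : P = P' := by
  rw [segment_eq_image'] at hP hP' hQ hQ'
  obtain ⟨s, hs, h1⟩ := hP
  obtain ⟨s', hs', h2⟩ := hP'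
  obtain ⟨u, hu, h3⟩ := hQ
  obtain ⟨u', hu', h4⟩ := hQ'
  simp only at h1 h2 h3 h4
  -- Reversing the second segment covers the case of opposite directions.
  have r3 : E + (1 - u) • (C - E) = P := by rw [← h3]; module
  have r4 : E + (1 - u') • (C - E) = P' := by rw [← h4]; module
  rw [segment_symm ℝ C E] at hA
  have hA' : A ∉ segment ℝ C E := by rwa [segment_symm]
  rcases lt_trichotomy s s' with h | h | h
  · rcases lt_trichotomy u u' with h' | h' | h'
    · exact absurd (mem_segment_or_mem_segment_of_lt hs.1 hs.2 hu.1 hu.2 h h' h1 h2 h3 h4)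
        (by tauto)
    · rw [← h3, ← h4, h']
    · exact absurd (mem_segment_or_mem_segment_of_lt hs.1 hs.2 (sub_nonneg.2 hu.2)
        (sub_le_self _ hu.1) h (sub_lt_sub_left h' 1) h1 h2 r3 r4) (by tauto)
  · rw [← h1, ← h2, h]
  · rcases lt_trichotomy u u' with h' | h' | h'
    · exact absurd (mem_segment_or_mem_segment_of_lt hs'.1 hs'.2 (sub_nonneg.2 hu'.2)
        (sub_le_self _ hu'.1) h (sub_lt_sub_left h' 1) h2 h1 r4 r3) (by tauto)
    · rw [← h3, ← h4, h']
    · exact absurd (mem_segment_or_mem_segment_of_lt hs'.1 hs'.2 hu'.1 hu'.2 h h' h2 h1 h4 h3)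
        (by tauto)

/-! ### Passages and vertices as times along the polygon -/

/-- The data by which the Gauss code `w` is read off from the diagram `D`. -/
structure Diagram.Reading (D : Diagram) (w : List Letter) where
  e : Fin w.length → Fin (D.n + 3)
  f : Fin w.length → Fin (D.n + 3)
  t : Fin w.length → ℝ
  mem : ∀ a, t a ∈ Set.Icc (0 : ℝ) 1 ∧
    D.pt (e a) + t a • D.dir (e a) ∈ segment ℝ (D.pt (f a)) (D.pt (f a + 1))
  mono : StrictMono fun a => ((e a : ℕ) : ℝ) + t a
  crossing : ∀ i j, (D.passesOver i j ∨ D.passesOver j i) ↔ ∃ a, e a = i ∧ f a = j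
  label_eq : ∀ a b, (w.get a).label = (w.get b).label ↔
    (e a = e b ∧ f a = f b) ∨ (e a = f b ∧ f a = e b)
  isOver_iff : ∀ a, (w.get a).isOver = true ↔ D.passesOver (e a) (f a)

theorem Diagram.HasGaussCode.nonempty_reading {D : Diagram} {w : List Letter}
    (h : D.HasGaussCode w) : Nonempty (D.Reading w) := by
  obtain ⟨e, f, t, h1, h2, h3, h4, h5, -⟩ := h
  exact ⟨⟨e, f, t, h1, h2, h3, h4, h5⟩⟩

namespace Diagram.Reading

variable {D : Diagram} {w : List Letter} (R : D.Reading w)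

/-- The time of a passage. -/
def pos (a : Fin w.length) : ℝ := ((R.e a : ℕ) : ℝ) + R.t a

/-- The point of a passage. -/
noncomputable def point (a : Fin w.length) : ℝ × ℝ := D.pt (R.e a) + R.t a • D.dir (R.e a)

theorem not_adjacent (a : Fin w.length) :
    R.e a ≠ R.f a ∧ R.e a ≠ R.f a + 1 ∧ R.f a ≠ R.e a + 1 := by
  rcases (R.crossing _ _).2 ⟨a, rfl, rfl⟩ with h | h
  · have := D.passesOver_crosses _ _ h
    exact ⟨this.1, this.2.1, this.2.2.1⟩
  · have := D.passesOver_crosses _ _ h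
    exact ⟨this.1.symm, this.2.2.1, this.2.1⟩

/-- A vertex lies on no edge other than its own two, so a passage is never at an end of its edge. -/
theorem t_pos (a : Fin w.length) : 0 < R.t a := by
  obtain ⟨h1, h2, h3⟩ := R.not_adjacent a
  obtain ⟨⟨h0, -⟩, h⟩ := R.mem a
  refine h0.lt_of_ne fun h' => D.vertex_notMem _ _ h1 h2 ?_
  simpa [← h'] using h

theorem t_lt_one (a : Fin w.length) : R.t a < 1 := by
  obtain ⟨h1, h2, h3⟩ := R.not_adjacent a
  obtain ⟨⟨-, h0⟩, h⟩ := R.mem a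
  refine h0.lt_of_ne fun h' => D.vertex_notMem (R.e a + 1) (R.f a) h3.symm ?_ ?_
  · exact fun h => h1 (add_right_cancel h)
  · simpa [h', Diagram.dir] using h

theorem point_mem (a : Fin w.length) :
    R.point a ∈ segment ℝ (D.pt (R.e a)) (D.pt (R.e a + 1)) := by
  rw [segment_eq_image']
  exact ⟨R.t a, (R.mem a).1, rfl⟩

/-- The two edges of a crossing meet only once. Hence both passages of a crossing have the same
height, as the extremal argument in `arcs_eq` requires. -/
theorem point_eq {a b : Fin w.length} (h : (w.get a).label = (w.get b).label) :
    R.point a = R.point b := by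
  obtain ⟨h1, h2, h3⟩ := R.not_adjacent a
  have hb : R.point b ∈ segment ℝ (D.pt (R.e a)) (D.pt (R.e a + 1)) ∧
      R.point b ∈ segment ℝ (D.pt (R.f a)) (D.pt (R.f a + 1)) := by
    rcases (R.label_eq a b).1 h with ⟨he, hf⟩ | ⟨he, hf⟩
    · rw [he, hf]
      exact ⟨R.point_mem b, (R.mem b).2⟩
    · rw [he, hf]
      exact ⟨(R.mem b).2, R.point_mem b⟩
  exact eq_of_mem_segment_inter (R.point_mem a) hb.1 (R.mem a).2 hb.2
    (D.vertex_notMem _ _ h1 h2) (D.vertex_notMem _ _ h1.symm h3)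
    (D.vertex_notMem _ _ h2.symm fun h => h1 (add_right_cancel h).symm)

theorem exists_partner (hw : IsGaussCode w) (a : Fin w.length) :
    ∃ b, (w.get b).label = (w.get a).label ∧ (w.get b).isOver = !(w.get a).isOver ∧
      (w.get b).sign = (w.get a).sign ∧ R.point b = R.point a := by
  obtain ⟨b, hb⟩ := List.get_of_mem (hw.2 _ (List.get_mem w a))
  have hl : (w.get b).label = (w.get a).label := by rw [hb]; rfl
  exact ⟨b, hl, by rw [hb]; rfl, by rw [hb]; rfl, R.point_eq hl⟩

/-- The vertex `v` lies between the passages number `k - 1` and `k`. -/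
def InArc (v : Fin (D.n + 3)) (k : ℕ) : Prop :=
  (∀ a : Fin w.length, (a : ℕ) < k → R.pos a < (v : ℕ)) ∧
    ∀ a : Fin w.length, k ≤ a → ((v : ℕ) : ℝ) ≤ R.pos a

theorem exists_inArc (v : Fin (D.n + 3)) : ∃ k ≤ w.length, R.InArc v k := by
  classical
  have hex : ∃ k : ℕ, ∀ a : Fin w.length, k ≤ a → ((v : ℕ) : ℝ) ≤ R.pos a :=
    ⟨w.length, fun a ha => absurd a.2 (not_lt.2 ha)⟩
  refine ⟨Nat.find hex, Nat.find_min' hex fun a ha => absurd a.2 (not_lt.2 ha),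
    fun a ha => ?_, Nat.find_spec hex⟩
  by_contra h
  exact Nat.find_min hex ha fun b hb => (not_lt.1 h).trans (R.mono.monotone hb)

/-- The heights of the vertices and passages on the arc number `k`. -/
def heights (k : ℕ) : Set ℝ :=
  {h | (∃ a : Fin w.length, ((a : ℕ) = k ∨ (a : ℕ) + 1 = k) ∧ h = (R.point a).2) ∨
    ∃ v, R.InArc v k ∧ h = (D.pt v).2}

theorem point_snd (a : Fin w.length) : (R.point a).2 =
    (D.pt (R.e a)).2 + R.t a * ((D.pt (R.e a + 1)).2 - (D.pt (R.e a)).2) := rfl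

theorem val_add_one {v u : Fin (D.n + 3)} (h : v < u) : ((v + 1 : Fin (D.n + 3)) : ℕ) = v + 1 :=
  Fin.val_add_one_of_lt (h.trans_le (Fin.le_last u))

/-- Follow a rising edge forward from the time `v + τ`: the next passage or vertex still belongs to
the arc `k` and is higher. Vertices use `τ = 0`, passages use `τ = t a`. -/
theorem exists_height_gt_of_lt {k : ℕ} (hk : k < w.length) {v : Fin (D.n + 3)} {τ : ℝ}
    (hτ : τ < 1) (hv : (D.pt v).2 < (D.pt (v + 1)).2)
    (h1 : ∀ a : Fin w.length, (a : ℕ) < k → R.pos a ≤ (v : ℕ) + τ)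
    (h2 : (v : ℕ) + τ < R.pos ⟨k, hk⟩) (hτ' : 0 ≤ τ) :
    ∃ h ∈ R.heights k, (D.pt v).2 + τ * ((D.pt (v + 1)).2 - (D.pt v).2) < h := by
  have hd := sub_pos.2 hv
  set b : Fin w.length := ⟨k, hk⟩
  have htb := R.t_lt_one b
  have hle : v ≤ R.e b := by
    by_contra hlt
    have : ((R.e b : ℕ) : ℝ) + 1 ≤ (v : ℕ) := by exact_mod_cast not_le.1 hlt
    simp only [pos] at h2
    linarith
  rcases hle.eq_or_lt with he | hlt
  · refine ⟨_, .inl ⟨b, .inl rfl, rfl⟩, ?_⟩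
    rw [point_snd, ← he]
    simp only [pos, ← he] at h2
    have : τ < R.t b := by linarith
    gcongr
  · have hval := val_add_one hlt
    have hle : (((v + 1 : Fin (D.n + 3)) : ℕ) : ℝ) ≤ (R.e b : ℕ) := by
      rw [hval]
      exact_mod_cast hlt
    refine ⟨_, .inr ⟨v + 1, ⟨fun a ha => ?_, fun a ha => ?_⟩, rfl⟩, ?_⟩
    · have := h1 a ha
      rw [hval]
      push_cast
      linarith
    · have h3 : R.pos b ≤ R.pos a := R.mono.monotone ha
      have h4 := R.t_pos b
      simp only [pos] at h3 ⊢
      linarith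
    · nlinarith

/-- The mirror image: follow a falling edge backward, on the arc that starts at the passage `k`.
Vertices now use `τ = 1` on the preceding edge. -/
theorem exists_height_gt_of_gt {k : ℕ} (hk : k < w.length) {v : Fin (D.n + 3)} {τ : ℝ}
    (hτ : 0 < τ) (hv : (D.pt (v + 1)).2 < (D.pt v).2)
    (h1 : R.pos ⟨k, hk⟩ < (v : ℕ) + τ)
    (h2 : ∀ a : Fin w.length, k < a → (v : ℕ) + τ ≤ R.pos a) (hτ' : τ ≤ 1) :
    ∃ h ∈ R.heights (k + 1), (D.pt v).2 + τ * ((D.pt (v + 1)).2 - (D.pt v).2) < h := by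
  have hd := sub_pos.2 hv
  set b : Fin w.length := ⟨k, hk⟩
  have htb := R.t_pos b
  have hle : R.e b ≤ v := by
    by_contra hlt
    have : ((v : ℕ) : ℝ) + 1 ≤ (R.e b : ℕ) := by exact_mod_cast not_le.1 hlt
    simp only [pos] at h1
    linarith
  rcases hle.eq_or_lt with he | hlt
  · refine ⟨_, .inl ⟨b, .inr rfl, rfl⟩, ?_⟩
    rw [point_snd, he]
    simp only [pos, he] at h1
    have : R.t b < τ := by linarith
    nlinarith
  · have hle : ((R.e b : ℕ) : ℝ) + 1 ≤ (v : ℕ) := by exact_mod_cast hlt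
    refine ⟨_, .inr ⟨v, ⟨fun a ha => ?_, fun a ha => ?_⟩, rfl⟩, ?_⟩
    · have h3 : R.pos a ≤ R.pos b := R.mono.monotone (Nat.lt_succ_iff.1 ha)
      have h4 := R.t_lt_one b
      simp only [pos] at h3 ⊢
      linarith
    · have := h2 a ha
      linarith
    · nlinarith

/-- Passages have `0 < t < 1`, so their times are never integers, while vertices have integer times.
-/
theorem pos_gt_of_le {v : Fin (D.n + 3)} {a : Fin w.length} (h : ((v : ℕ) : ℝ) ≤ R.pos a) :
    ((v : ℕ) : ℝ) < R.pos a := by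
  refine h.lt_of_ne fun h' => ?_
  have h1 := R.t_pos a
  have h2 := R.t_lt_one a
  simp only [pos] at h'
  have h3 : (R.e a : ℕ) < (v : ℕ) := by
    have : ((R.e a : ℕ) : ℝ) < (v : ℕ) := by linarith
    exact_mod_cast this
  have : ((R.e a : ℕ) : ℝ) + 1 ≤ (v : ℕ) := by exact_mod_cast h3
  linarith

/-- A vertex on an arc between two passages is a local maximum, or there is a higher vertex or passage
on the arc. -/
theorem exists_height_gt_of_inArc {k : ℕ} (hk0 : 0 < k) (hk : k < w.length)
    {u : Fin (D.n + 3)} (hu : R.InArc u k)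
    (hmax : ∀ i, (D.pt i).2 < (D.pt (i + 1)).2 → (D.pt (i + 1 + 1)).2 < (D.pt (i + 1)).2 →
      i + 1 ≠ u) : ∃ h ∈ R.heights k, (D.pt u).2 < h := by
  rcases (D.height_ne u).lt_or_gt with h | h
  · obtain ⟨x, hx, hlt⟩ := R.exists_height_gt_of_lt hk (v := u) (τ := 0) one_pos h
      (fun a ha => by simpa using (hu.1 a ha).le)
      (by simpa using R.pos_gt_of_le (hu.2 ⟨k, hk⟩ le_rfl)) le_rfl
    exact ⟨x, hx, by simpa using hlt⟩
  · obtain ⟨k, rfl⟩ := Nat.exists_eq_succ_of_ne_zero hk0.ne'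
    have hk' : k < w.length := by omega
    have hpos := hu.1 ⟨k, hk'⟩ (Nat.lt_succ_self k)
    -- A passage precedes `u`, so `u` is not the base vertex and `u - 1` does not wrap around.
    have hu0 : u ≠ 0 := by
      rintro rfl
      have := R.t_pos ⟨k, hk'⟩
      simp only [pos, Fin.val_zero, Nat.cast_zero] at hpos
      have : (0 : ℝ) ≤ (R.e ⟨k, hk'⟩ : ℕ) := Nat.cast_nonneg _
      linarith
    have hv : u - 1 + 1 = u := sub_add_cancel u 1
    have hval : ((u - 1 : Fin (D.n + 3)) : ℕ) + 1 = u := by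
      rw [Fin.val_sub_one_of_ne_zero hu0]
      have : (u : ℕ) ≠ 0 := fun h => hu0 (Fin.ext h)
      omega
    have hval' : (((u - 1 : Fin (D.n + 3)) : ℕ) : ℝ) + 1 = (u : ℕ) := by exact_mod_cast hval
    have hlt : (D.pt (u - 1 + 1)).2 < (D.pt (u - 1)).2 := by
      refine lt_of_not_ge fun hge => ?_
      have hne := D.height_ne (u - 1)
      refine hmax (u - 1) (lt_of_le_of_ne hge hne) ?_ hv
      rwa [hv]
    obtain ⟨x, hx, hlt⟩ := R.exists_height_gt_of_gt hk' (v := u - 1) (τ := 1) one_pos hlt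
      (by rwa [hval']) (fun a ha => by rw [hval']; exact hu.2 a ha) le_rfl
    refine ⟨x, hx, ?_⟩
    rw [hv] at hlt
    linarith

/-- The number of the arc that reaches the `a`-th passage from above. -/
noncomputable def upper (a : Fin w.length) : ℕ :=
  if (D.pt (R.e a)).2 < (D.pt (R.e a + 1)).2 then a + 1 else a

theorem exists_height_gt_of_upper {k : ℕ} (hk0 : 0 < k) (hk : k < w.length)
    {a : Fin w.length} (ha : R.upper a = k) : ∃ h ∈ R.heights k, (R.point a).2 < h := by
  rw [upper] at ha
  split_ifs at ha with h
  · refine R.exists_height_gt_of_lt hk (v := R.e a) (τ := R.t a) (R.t_lt_one a) h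
      (fun b hb => ?_) ?_ (R.t_pos a).le
    · have hb' : b ≤ a := Fin.le_def.2 (by omega)
      exact R.mono.monotone hb'
    · exact R.mono (Fin.lt_def.2 (by simp only; omega))
  · obtain ⟨k, rfl⟩ := Nat.exists_eq_succ_of_ne_zero hk0.ne'
    have h' := lt_of_le_of_ne (not_lt.1 h) (D.height_ne _).symm
    refine R.exists_height_gt_of_gt (by omega) (v := R.e a) (τ := R.t a) (R.t_pos a) h'
      ?_ (fun b hb => ?_) (R.t_lt_one a).le
    · exact R.mono (Fin.lt_def.2 (by simp only; omega))
    · have hb' : a ≤ b := Fin.le_def.2 (by omega)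
      exact R.mono.monotone hb'

end Diagram.Reading

/-! ### Colorings are determined by the base point and the maxima -/

/-- The colors of the arcs of a colored word. -/
theorem Fits.exists_arcs {X : Type} {B : Biquandle X} {κ : ℕ → X × X} {w : List Letter} {s t : X}
    (h : Fits B κ w s t) : ∃ c : ℕ → X, c 0 = s ∧ c w.length = t ∧
      ∀ a : Fin w.length, c a = inColor κ (w.get a) ∧ c (a + 1) = outColor B κ (w.get a) := by
  induction w generalizing s with
  | nil => exact ⟨fun _ => s, rfl, h, fun a => a.elim0⟩
  | cons e w ih =>
    obtain ⟨h1, h2⟩ := h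
    obtain ⟨c, c0, c1, hc⟩ := ih h2
    refine ⟨fun k => k.casesOn s c, rfl, c1, fun a => ?_⟩
    refine Fin.cases ⟨h1, c0⟩ (fun b => hc b) a

/-- Two colorings that agree at the base point and at all local maxima agree on all arcs. -/
theorem Diagram.Reading.arcs_eq {D : Diagram} {w : List Letter} (R : D.Reading w)
    (hw : IsGaussCode w) {X : Type} {B : Biquandle X} {κ κ' : ℕ → X × X} {c c' : ℕ → X}
    (hc : ∀ a : Fin w.length, c a = inColor κ (w.get a) ∧ c (a + 1) = outColor B κ (w.get a))
    (hc' : ∀ a : Fin w.length,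
      c' a = inColor κ' (w.get a) ∧ c' (a + 1) = outColor B κ' (w.get a))
    (h0 : c 0 = c' 0) (h1 : c w.length = c' w.length)
    (hmax : ∀ i, (D.pt i).2 < (D.pt (i + 1)).2 → (D.pt (i + 1 + 1)).2 < (D.pt (i + 1)).2 →
      ∀ k ≤ w.length, R.InArc (i + 1) k → c k = c' k) : ∀ k ≤ w.length, c k = c' k := by
  by_contra! hbad
  have hb : ∀ k ≤ w.length, c k ≠ c' k → 0 < k ∧ k < w.length := fun k hk hne =>
    ⟨Nat.pos_of_ne_zero fun h => hne (h ▸ h0), hk.lt_of_ne fun h => hne (h ▸ h1)⟩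
  -- Take the highest vertex or passage on an arc where the colorings differ. By `hb` such an arc
  -- avoids the base point.
  set S : Set ℝ := {h | ∃ k ≤ w.length, c k ≠ c' k ∧ h ∈ R.heights k} with hS
  have hfin : S.Finite := by
    refine ((Set.finite_range fun a => (R.point a).2).union
      (Set.finite_range fun v => (D.pt v).2)).subset ?_
    rintro _ ⟨k, -, -, ⟨a, -, rfl⟩ | ⟨v, -, rfl⟩⟩
    · exact .inl ⟨a, rfl⟩
    · exact .inr ⟨v, rfl⟩
  have hne : S.Nonempty := by
    obtain ⟨k, hk, hne⟩ := hbad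
    exact ⟨_, k, hk, hne, .inl ⟨⟨k, (hb k hk hne).2⟩, .inl rfl, rfl⟩⟩
  obtain ⟨x, ⟨k, hk, hck, hx⟩, hmaxx⟩ := Set.exists_max_image S id hfin hne
  have hno : ∀ k ≤ w.length, c k ≠ c' k → ∀ y ∈ R.heights k, ¬ x < y := fun k hk hne y hy hlt =>
    (hmaxx y ⟨k, hk, hne, hy⟩).not_gt hlt
  -- The arc that reaches a passage at height `x` from above contains something higher, so the
  -- colorings agree on it.
  have hup : ∀ a, (R.point a).2 = x → c (R.upper a) = c' (R.upper a) := by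
    intro a ha
    by_contra hne
    have hle : R.upper a ≤ w.length := by
      have := a.2
      rw [Diagram.Reading.upper]
      split_ifs <;> omega
    obtain ⟨hu0, hu1⟩ := hb _ hle hne
    obtain ⟨y, hy, hlt⟩ := R.exists_height_gt_of_upper hu0 hu1 rfl
    exact hno _ hle hne y hy (ha ▸ hlt)
  rcases hx with ⟨a, hak, rfl⟩ | ⟨v, hv, rfl⟩
  · have hside : ∀ b, (R.point b).2 = (R.point a).2 →
        (inColor κ (w.get b) = inColor κ' (w.get b) ∨
          outColor B κ (w.get b) = outColor B κ' (w.get b)) := by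
      intro b hb
      have := hup b hb
      rw [Diagram.Reading.upper] at this
      split_ifs at this
      · exact .inr (by rw [← (hc b).2, ← (hc' b).2, this])
      · exact .inl (by rw [← (hc b).1, ← (hc' b).1, this])
    obtain ⟨b, hbl, hbo, hbs, hbp⟩ := R.exists_partner hw a
    have ha1 := hside a rfl
    have hb1 := hside b (by rw [hbp])
    -- Both strands reach the crossing from above with agreed colors, so the whole crossing agrees,
    -- including the arc `k`.
    have hκ : κ (w.get a).label = κ' (w.get a).label := by
      rcases ho : (w.get a).isOver with _ | _
      · rw [ho] at hbo
        simp only [inColor, outColor, hbl, hbo, hbs, ho] at ha1 hb1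
        exact B.crossing_ext _ ha1 hb1
      · rw [ho] at hbo
        simp only [inColor, outColor, hbl, hbo, hbs, ho] at ha1 hb1
        exact B.crossing_ext _ hb1 ha1
    apply hck
    rcases hak with rfl | rfl
    · rw [(hc a).1, (hc' a).1, inColor, inColor, hκ]
    · rw [(hc a).2, (hc' a).2, outColor, outColor, hκ]
  · obtain ⟨hk0, hk1⟩ := hb k hk hck
    obtain ⟨y, hy, hlt⟩ := R.exists_height_gt_of_inArc hk0 hk1 hv
      fun i hi hi' h => hck (hmax i hi hi' k hk (h ▸ hv))
    exact hno k hk hck y hy hlt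

open Cardinal

/-- A coloring is recorded by its color at each maximum and, for the extra 1 in the exponent, its
color at the base point. -/
theorem Diagram.HasGaussCode.mk_coloring_le {D : Diagram} {w : List Letter}
    (h : D.HasGaussCode w) (hw : IsGaussCode w) {X : Type} [Inhabited X] (B : Biquandle X) :
    #(Coloring B w) ≤ #X ^ (D.numMaxima + 1) := by
  classical
  obtain ⟨R⟩ := h.nonempty_reading
  choose arc harc_le harc using R.exists_inArc
  choose c c0 c1 hc using fun p : Coloring B w => p.2.2.1.exists_arcs
  set M : Set (Fin (D.n + 3)) :=
    {i | (D.pt i).2 < (D.pt (i + 1)).2 ∧ (D.pt (i + 1 + 1)).2 < (D.pt (i + 1)).2} with hM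
  have hcard : #(X × (M → X)) = #X ^ (D.numMaxima + 1) := by
    have : #M = (D.numMaxima : Cardinal) := by
      rw [Diagram.numMaxima, ← hM, Set.cast_ncard (Set.toFinite M)]
    rw [mk_prod, lift_id, lift_id, pow_succ', ← power_def, this, power_natCast]
  rw [← hcard]
  refine mk_le_of_injective (f := fun p => (p.1, fun i : M => c p (arc (i + 1))))
    fun p p' hpp => ?_
  obtain ⟨hs, hrec⟩ := Prod.mk.inj hpp
  have hrec' : ∀ i ∈ M, c p (arc (i + 1)) = c p' (arc (i + 1)) := fun i hi =>
    congrFun hrec ⟨i, hi⟩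
  have huniq : ∀ v k, k ≤ w.length → R.InArc v k → k = arc v := by
    intro v k hk hkv
    have hv := harc v
    have hle := harc_le v
    rcases lt_trichotomy k (arc v) with hlt | heq | hlt
    · have h1 := hkv.2 ⟨k, by omega⟩ le_rfl
      have h2 := hv.1 ⟨k, by omega⟩ hlt
      exact absurd h1 (not_le.2 h2)
    · exact heq
    · have h1 := hv.2 ⟨arc v, by omega⟩ le_rfl
      have h2 := hkv.1 ⟨arc v, by omega⟩ hlt
      exact absurd h1 (not_le.2 h2)
  have heq := R.arcs_eq hw (hc p) (hc p') (by rw [c0, c0, hs]) (by rw [c1, c1, hs]) ?_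
  · have hκ : p.2.1 = p'.2.1 := by
      funext l
      by_cases hl : l ∈ labels w
      · obtain ⟨e, he, rfl⟩ := List.mem_map.1 hl
        obtain ⟨f, hf, hfe, hfo⟩ := hw.exists_isOver he true
        obtain ⟨g, hg, hge, hgo⟩ := hw.exists_isOver he false
        obtain ⟨a, rfl⟩ := List.get_of_mem hf
        obtain ⟨b, rfl⟩ := List.get_of_mem hg
        have ha := heq a a.2.le
        have hb := heq b b.2.le
        rw [(hc p a).1, (hc p' a).1] at ha
        rw [(hc p b).1, (hc p' b).1] at hb
        simp only [inColor, hfo, hfe, hgo, hge] at ha hb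
        exact Prod.ext hb ha
      · rw [p.2.2.2 l hl, p'.2.2.2 l hl]
    obtain ⟨s, κ, h⟩ := p
    obtain ⟨s', κ', h'⟩ := p'
    obtain rfl : s = s' := hs
    obtain rfl : κ = κ' := hκ
    rfl
  · intro i hi hi' k hk hik
    rw [huniq _ _ hk hik]
    exact hrec' i ⟨hi, hi'⟩

theorem le_numMaxima_add_one {K : VirtualKnot} {n r : ℕ} {w : List Letter} {D : Diagram}
    (hK : K.IsRepresentedBy (sumCode n r)) (hw : K.IsRepresentedBy w) (hD : D.HasGaussCode w) :
    n ≤ D.numMaxima + 1 := by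
  have h := (four_pow_le_mk_coloring_sumCode n r).trans
    ((mk_coloring_eq_of_isRepresentedBy hK hw).trans_le
      (hD.mk_coloring_le hw.choose kishinoBiquandle))
  have hX : #(Bool × Bool) = 4 := by simp
  rw [hX] at h
  have h' : (4 : ℕ) ^ n ≤ 4 ^ (D.numMaxima + 1) := by exact_mod_cast h
  exact (Nat.pow_le_pow_iff_right (by norm_num)).1 h'

theorem le_secondBridgeNumber_add_one {K : VirtualKnot} {n r : ℕ}
    (hK : K.IsRepresentedBy (sumCode n r)) : (n : ℕ∞) ≤ K.secondBridgeNumber + 1 := by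
  rw [← tsub_le_iff_right]
  refine le_iInf fun D => le_iInf fun w => le_iInf fun h => ?_
  rw [tsub_le_iff_right]
  exact_mod_cast le_numMaxima_add_one hK h.2 h.1

/-! ### Moving over-letters in front of under-letters -/

/-- Two words that are Gauss codes of the same virtual knot. -/
def SameKnot (w w' : List Letter) : Prop :=
  ∃ (h : IsGaussCode w) (h' : IsGaussCode w'),
    (Quot.mk _ ⟨w, h⟩ : VirtualKnot) = Quot.mk _ ⟨w', h'⟩

theorem SameKnot.refl {w : List Letter} (h : IsGaussCode w) : SameKnot w w := ⟨h, h, rfl⟩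

theorem SameKnot.symm {w w' : List Letter} (h : SameKnot w w') : SameKnot w' w :=
  ⟨h.2.1, h.1, h.2.2.symm⟩

theorem SameKnot.trans {w w' w'' : List Letter} (h : SameKnot w w') (h' : SameKnot w' w'') :
    SameKnot w w'' :=
  ⟨h.1, h'.2.1, h.2.2.trans h'.2.2⟩

theorem sameKnot_of_move {w w' : List Letter} (h : IsGaussCode w) (h' : IsGaussCode w')
    (hm : Move w w') : SameKnot w w' :=
  ⟨h, h', Quot.sound (r := fun g h : GaussCode => Move g.1 h.1) (a := ⟨w, h⟩) (b := ⟨w', h'⟩) hm⟩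

theorem sameKnot_rotate {u v : List Letter} (h : IsGaussCode (u ++ v)) :
    SameKnot (u ++ v) (v ++ u) :=
  sameKnot_of_move h ((isGaussCode_perm List.perm_append_comm).1 h) (Move.rotate u v)

theorem sameKnot_r2 {a b : ℕ} (s d : Bool) {u v : List Letter} (h : IsGaussCode (u ++ v))
    (hab : a ≠ b) (ha : a ∉ labels (u ++ v)) (hb : b ∉ labels (u ++ v)) :
    SameKnot (u ++ v) ([⟨a, true, s⟩, ⟨b, true, !s⟩] ++ u ++
      inOrder d ⟨a, false, s⟩ ⟨b, false, !s⟩ ++ v) := by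
  refine sameKnot_of_move h ?_ (Move.r2 a b s d u v)
  refine (isGaussCode_perm (r2_perm a b s (!s) d true u v)).2 ?_
  rw [isGaussCode_cons_cons, isGaussCode_cons_cons]
  refine ⟨?_, hb, h⟩
  simp only [labels, List.map_cons, List.mem_cons, not_or]
  exact ⟨hab, hab, ha⟩

theorem sameKnot_r3 {a b c : ℕ} {x y z ε : Bool} {u v w : List Letter}
    (h : IsGaussCode (topPair a b x y z ε ++ u ++ middlePair a c x z ε ++ v ++
      bottomPair b c y z ε ++ w)) :
    SameKnot (topPair a b x y z ε ++ u ++ middlePair a c x z ε ++ v ++ bottomPair b c y z ε ++ w)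
      (topPair a b x y z (!ε) ++ u ++ middlePair a c x z (!ε) ++ v ++
        bottomPair b c y z (!ε) ++ w) := by
  have hp := fun ε => r3_perm a b c x y z ε u v w
  have h' := (isGaussCode_perm ((hp ε).trans (hp (!ε)).symm)).1 h
  have hm := Move.r3 a b c x y z u v w
  cases ε
  · refine (sameKnot_of_move h' h ?_).symm
    simpa [topPair, middlePair, bottomPair] using hm
  · refine sameKnot_of_move h h' ?_
    simpa [topPair, middlePair, bottomPair] using hm

theorem sameKnot_r3' {a b c : ℕ} {x y z ε : Bool} {u v w : List Letter}
    (h : IsGaussCode (topPair a b x y z ε ++ u ++ bottomPair b c y z ε ++ v ++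
      middlePair a c x z ε ++ w)) :
    SameKnot (topPair a b x y z ε ++ u ++ bottomPair b c y z ε ++ v ++ middlePair a c x z ε ++ w)
      (topPair a b x y z (!ε) ++ u ++ bottomPair b c y z (!ε) ++ v ++
        middlePair a c x z (!ε) ++ w) := by
  have hp := fun ε => r3'_perm a b c x y z ε u v w
  have h' := (isGaussCode_perm ((hp ε).trans (hp (!ε)).symm)).1 h
  have hm := Move.r3' a b c x y z u v w
  cases ε
  · refine (sameKnot_of_move h' h ?_).symm
    simpa [topPair, middlePair, bottomPair] using hm
  · refine sameKnot_of_move h h' ?_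
    simpa [topPair, middlePair, bottomPair] using hm

/-- The substitution `f` replaces every letter by a nonempty word of letters of the same height, and
changes only over-letters with labels in `A` and under-letters with labels in `B`. -/
structure Inflation (A B : List ℕ) (f : Letter → List Letter) : Prop where
  ne_nil : ∀ e, f e ≠ []
  isOver_eq : ∀ e, ∀ x ∈ f e, x.isOver = e.isOver
  over_eq : ∀ e : Letter, e.isOver = true → e.label ∉ A → f e = [e]
  under_eq : ∀ e : Letter, e.isOver = false → e.label ∉ B → f e = [e]

theorem flatMap_eq_self {f : Letter → List Letter} {w : List Letter} (h : ∀ e ∈ w, f e = [e]) :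
    w.flatMap f = w := by
  induction w with
  | nil => rfl
  | cons e w ih => simp [h e (by simp), ih fun e he => h e (by simp [he])]

theorem inflation_singleton (A B : List ℕ) : Inflation A B fun e => [e] :=
  ⟨by simp, by simp, fun _ _ _ => rfl, fun _ _ _ => rfl⟩

theorem Inflation.comp {A B A₁ B₁ A₂ B₂ : List ℕ} {f g : Letter → List Letter}
    (hf : Inflation A₁ B₁ f) (hg : Inflation A₂ B₂ g) (hA₁ : A₁ ⊆ A) (hB₁ : B₁ ⊆ B)
    (hA₂ : A₂ ⊆ A) (hB₂ : B₂ ⊆ B) : Inflation A B fun e => (f e).flatMap g := by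
  refine ⟨fun e h => ?_, fun e x hx => ?_, fun e he hl => ?_, fun e he hl => ?_⟩
  · obtain ⟨y, hy⟩ := List.exists_mem_of_ne_nil _ (hf.ne_nil e)
    exact hg.ne_nil y (List.flatMap_eq_nil_iff.1 h y hy)
  · obtain ⟨y, hy, hx⟩ := List.mem_flatMap.1 hx
    rw [hg.isOver_eq y x hx, hf.isOver_eq e y hy]
  · simp [hf.over_eq e he fun h => hl (hA₁ h), hg.over_eq e he fun h => hl (hA₂ h)]
  · simp [hf.under_eq e he fun h => hl (hB₁ h), hg.under_eq e he fun h => hl (hB₂ h)]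

theorem exists_notMem_list (l : List ℕ) : ∃ a, a ∉ l := by
  obtain ⟨a, ha⟩ := Infinite.exists_notMem_finset l.toFinset
  exact ⟨a, by simpa using ha⟩

theorem IsGaussCode.ne_of_perm {w u : List Letter} {e f : Letter} (h : IsGaussCode w)
    (hp : w.Perm (e :: f :: u)) : ∀ x ∈ u, (x.label, x.isOver) ≠ (e.label, e.isOver) ∧
      (x.label, x.isOver) ≠ (f.label, f.isOver) := by
  have hn := ((isGaussCode_perm hp).1 h).1
  simp only [List.map_cons, List.nodup_cons, List.mem_cons, List.mem_map, not_or, not_exists,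
    not_and] at hn
  exact fun x hx => ⟨hn.1.2 x hx, hn.2.1 x hx⟩

/-- An under-letter can be moved past the over-letter that follows it. -/
theorem exists_sameKnot_swap {a b : ℕ} {x z : Bool} {w : List Letter} (hab : a ≠ b)
    (h : IsGaussCode ([⟨a, false, x⟩, ⟨b, true, z⟩] ++ w)) :
    ∃ f, Inflation [a] [b] f ∧ SameKnot ([⟨a, false, x⟩, ⟨b, true, z⟩] ++ w)
      ([⟨b, true, z⟩, ⟨a, false, x⟩] ++ w.flatMap f) := by
  classical
  set W : List Letter := [⟨a, false, x⟩, ⟨b, true, z⟩] ++ w with hW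
  obtain ⟨c, hc⟩ := exists_notMem_list (labels W)
  obtain ⟨d, hd⟩ := exists_notMem_list (c :: labels W)
  rw [List.mem_cons, not_or] at hd
  obtain ⟨hcd, hd⟩ := hd
  -- The over-strand of `a` is pushed across the under-strand of `b`, with new crossings `c` and
  -- `d`; a third move on `a`, `c`, `b` then swaps the two letters. Whether the under-letter of `d`
  -- comes before or after depends on the order of `c` and `b` that this third move requires.
  set P : List Letter := if x == z then [⟨d, false, !z⟩] else [] with hP
  set Q : List Letter := if x == z then [] else [⟨d, false, !z⟩] with hQ
  have hPQ : ∀ e ∈ P ++ bottomPair c b z z (!x) ++ Q, e.isOver = false := by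
    intro e he
    cases x <;> cases z <;> simp [hP, hQ, bottomPair, inOrder] at he <;> aesop
  set f : Letter → List Letter := fun e =>
    if e.isOver = true ∧ e.label = a then [⟨c, true, z⟩, e, ⟨d, true, !z⟩]
    else if e.isOver = false ∧ e.label = b then P ++ bottomPair c b z z (!x) ++ Q else [e] with hf
  have hinf : Inflation [a] [b] f := by
    refine ⟨fun e => ?_, fun e y hy => ?_, fun e he hl => ?_, fun e he hl => ?_⟩
    · simp only [hf]
      split_ifs
      · simp
      · cases x <;> cases z <;> simp [bottomPair, inOrder]
      · simp
    · simp only [hf] at hy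
      split_ifs at hy with h1 h2
      · simp only [List.mem_cons, List.not_mem_nil, or_false] at hy
        rcases hy with rfl | rfl | rfl
        exacts [h1.1.symm, rfl, h1.1.symm]
      · rw [hPQ y hy, h2.1]
      · rw [List.mem_singleton.1 hy]
    · have : e.label ≠ a := by simpa using hl
      simp [hf, he, this]
    · have : e.label ≠ b := by simpa using hl
      simp [hf, he, this]
  refine ⟨f, hinf, ?_⟩
  have hA : (⟨a, true, x⟩ : Letter) ∈ w := by
    have := h.2 ⟨a, false, x⟩ (by simp [hW])
    simpa [Letter.partner, hW, hab] using this
  have hB : (⟨b, false, z⟩ : Letter) ∈ w := by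
    have := h.2 ⟨b, true, z⟩ (by simp [hW])
    simpa [Letter.partner, hW, hab.symm] using this
  have hfA : f ⟨a, true, x⟩ = [⟨c, true, z⟩, ⟨a, true, x⟩, ⟨d, true, !z⟩] := by simp [hf]
  have hfB : f ⟨b, false, z⟩ = P ++ bottomPair c b z z (!x) ++ Q := by simp [hf]
  have hfix : ∀ u : List Letter, (∀ e ∈ u, (e.label, e.isOver) ≠ (a, true)) →
      (∀ e ∈ u, (e.label, e.isOver) ≠ (b, false)) → u.flatMap f = u := by
    intro u h1 h2
    refine flatMap_eq_self fun e he => ?_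
    simp only [hf]
    rw [if_neg fun h3 => h1 e he (Prod.ext h3.2 h3.1),
      if_neg fun h3 => h2 e he (Prod.ext h3.2 h3.1)]
  have htop : topPair a c x z z x = [⟨a, true, x⟩, ⟨c, true, z⟩] := by simp [topPair, inOrder]
  have htop' : topPair a c x z z (!x) = [⟨c, true, z⟩, ⟨a, true, x⟩] := by
    simp [topPair, inOrder]
  have hmid : middlePair a b x z x = [⟨a, false, x⟩, ⟨b, true, z⟩] := by
    simp [middlePair, inOrder]
  have hmid' : middlePair a b x z (!x) = [⟨b, true, z⟩, ⟨a, false, x⟩] := by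
    simp [middlePair, inOrder]
  have hr2 : ∀ u v : List Letter, IsGaussCode (u ++ [⟨b, false, z⟩] ++ v) →
      c ∉ labels (u ++ [⟨b, false, z⟩] ++ v) → d ∉ labels (u ++ [⟨b, false, z⟩] ++ v) →
      SameKnot (u ++ [⟨b, false, z⟩] ++ v) ([⟨c, true, z⟩, ⟨d, true, !z⟩] ++ u ++
        (P ++ bottomPair c b z z x ++ Q) ++ v) := by
    intro u v h1 h2 h3
    by_cases hxz : x = z
    · have := sameKnot_r2 (a := c) (b := d) z false (u := u) (v := [⟨b, false, z⟩] ++ v)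
        (by simpa using h1) (Ne.symm hcd) (by simpa using h2) (by simpa using h3)
      simpa [hP, hQ, bottomPair, inOrder, hxz] using this
    · have := sameKnot_r2 (a := c) (b := d) z true (u := u ++ [⟨b, false, z⟩]) (v := v)
        (by simpa using h1) (Ne.symm hcd) (by simpa using h2) (by simpa using h3)
      simpa [hP, hQ, bottomPair, inOrder, hxz] using this
  obtain ⟨u, v, hw⟩ := List.append_of_mem hA
  have hB' : (⟨b, false, z⟩ : Letter) ∈ u ∨ (⟨b, false, z⟩ : Letter) ∈ v := by
    rw [hw] at hB
    simpa using hB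
  rcases hB' with hB' | hB'
  · obtain ⟨u₁, u₂, rfl⟩ := List.append_of_mem hB'
    have e1 : W = ([⟨a, false, x⟩, ⟨b, true, z⟩] ++ u₁ ++ [⟨b, false, z⟩] ++ u₂ ++
        [⟨a, true, x⟩]) ++ v := by simp [hW, hw]
    rw [e1] at h hc hd ⊢
    have hn := h.ne_of_perm (e := ⟨a, true, x⟩) (f := ⟨b, false, z⟩)
      (u := ⟨a, false, x⟩ :: ⟨b, true, z⟩ :: (u₁ ++ u₂ ++ v)) (by
        rw [List.perm_iff_count]
        intro q
        simp only [List.count_append, List.count_cons, List.count_nil]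
        ring)
    have hwf : w.flatMap f = u₁ ++ (P ++ bottomPair c b z z (!x) ++ Q) ++ u₂ ++
        [⟨c, true, z⟩, ⟨a, true, x⟩, ⟨d, true, !z⟩] ++ v := by
      rw [hw]
      simp only [List.flatMap_append, List.flatMap_cons, hfA, hfB]
      rw [hfix u₁, hfix u₂, hfix v]
      · simp
      all_goals
        intro e he
        have := hn e (by simp [he])
        tauto
    -- Cyclically, the top strand is followed by the middle and then the bottom one, so `r3`
    -- applies; if `Ub` comes after `Oa`, it is `r3'`.
    have s1 := sameKnot_rotate h
    have s2 := hr2 (v ++ [⟨a, false, x⟩, ⟨b, true, z⟩] ++ u₁) (u₂ ++ [⟨a, true, x⟩])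
      (by simpa using s1.2.1) (by simp [labels] at hc ⊢; tauto) (by simp [labels] at hd ⊢; tauto)
    have s3 := sameKnot_rotate (u := [⟨c, true, z⟩, ⟨d, true, !z⟩] ++
      (v ++ [⟨a, false, x⟩, ⟨b, true, z⟩] ++ u₁) ++ (P ++ bottomPair c b z z x ++ Q) ++ u₂)
      (v := [⟨a, true, x⟩]) (by simpa using s2.2.1)
    have s4 := sameKnot_r3 (a := a) (b := c) (c := b) (x := x) (y := z) (z := z) (ε := x)
      (u := ⟨d, true, !z⟩ :: v) (v := u₁ ++ P) (w := Q ++ u₂)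
      (by rw [htop, hmid]; simpa using s3.2.1)
    rw [htop, hmid, htop', hmid'] at s4
    have s5 := sameKnot_rotate (u := [⟨c, true, z⟩, ⟨a, true, x⟩] ++ ⟨d, true, !z⟩ :: v)
      (v := [⟨b, true, z⟩, ⟨a, false, x⟩] ++ (u₁ ++ P) ++ bottomPair c b z z (!x) ++ (Q ++ u₂))
      (by simpa using s4.2.1)
    simp only [List.append_assoc, List.cons_append, List.nil_append] at s1 s2 s3 s4 s5 hwf ⊢
    rw [hwf]
    exact s1.trans (s2.trans (s3.trans (s4.trans s5)))
  · obtain ⟨v₁, v₂, rfl⟩ := List.append_of_mem hB'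
    have e1 : W = ([⟨a, false, x⟩, ⟨b, true, z⟩] ++ u ++ [⟨a, true, x⟩]) ++
        (v₁ ++ [⟨b, false, z⟩] ++ v₂) := by simp [hW, hw]
    rw [e1] at h hc hd ⊢
    have hn := h.ne_of_perm (e := ⟨a, true, x⟩) (f := ⟨b, false, z⟩)
      (u := ⟨a, false, x⟩ :: ⟨b, true, z⟩ :: (u ++ v₁ ++ v₂)) (by
        rw [List.perm_iff_count]
        intro q
        simp only [List.count_append, List.count_cons, List.count_nil]
        ring)
    have hwf : w.flatMap f = u ++ [⟨c, true, z⟩, ⟨a, true, x⟩, ⟨d, true, !z⟩] ++ v₁ ++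
        (P ++ bottomPair c b z z (!x) ++ Q) ++ v₂ := by
      rw [hw]
      simp only [List.flatMap_append, List.flatMap_cons, hfA, hfB]
      rw [hfix u, hfix v₁, hfix v₂]
      · simp
      all_goals
        intro e he
        have := hn e (by simp [he])
        tauto
    have s1 := sameKnot_rotate h
    have s2 := hr2 v₁ (v₂ ++ [⟨a, false, x⟩, ⟨b, true, z⟩] ++ u ++ [⟨a, true, x⟩])
      (by simpa using s1.2.1) (by simp [labels] at hc ⊢; tauto) (by simp [labels] at hd ⊢; tauto)
    have s3 := sameKnot_rotate (u := [⟨c, true, z⟩, ⟨d, true, !z⟩] ++ v₁ ++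
      (P ++ bottomPair c b z z x ++ Q) ++ v₂ ++ [⟨a, false, x⟩, ⟨b, true, z⟩] ++ u)
      (v := [⟨a, true, x⟩]) (by simpa using s2.2.1)
    have s4 := sameKnot_r3' (a := a) (b := c) (c := b) (x := x) (y := z) (z := z) (ε := x)
      (u := ⟨d, true, !z⟩ :: (v₁ ++ P)) (v := Q ++ v₂) (w := u)
      (by rw [htop, hmid]; simpa using s3.2.1)
    rw [htop, hmid, htop', hmid'] at s4
    have s5 := sameKnot_rotate (u := [⟨c, true, z⟩, ⟨a, true, x⟩] ++ ⟨d, true, !z⟩ :: (v₁ ++ P) ++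
      bottomPair c b z z (!x) ++ (Q ++ v₂))
      (v := [⟨b, true, z⟩, ⟨a, false, x⟩] ++ u) (by simpa using s4.2.1)
    simp only [List.append_assoc, List.cons_append, List.nil_append] at s1 s2 s3 s4 s5 hwf ⊢
    rw [hwf]
    exact s1.trans (s2.trans (s3.trans (s4.trans s5)))

/-- One swap per over-letter. An over-letter already passed is rotated to the end and stays intact,
since later swaps expand only over-letters with the label `a`. -/
theorem exists_sameKnot_move_under {a : ℕ} {x : Bool} {v w : List Letter}
    (hv : ∀ e ∈ v, e.isOver = true) (ha : a ∉ labels v)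
    (h : IsGaussCode (⟨a, false, x⟩ :: (v ++ w))) :
    ∃ f, Inflation [a] (labels v) f ∧ SameKnot (⟨a, false, x⟩ :: (v ++ w))
      (v ++ ⟨a, false, x⟩ :: w.flatMap f) := by
  induction v generalizing w with
  | nil => exact ⟨_, inflation_singleton _ _, by simpa using SameKnot.refl h⟩
  | cons e v ih =>
    obtain ⟨b, o, z⟩ := e
    obtain rfl : o = true := hv ⟨b, o, z⟩ (by simp)
    have ha' : a ≠ b ∧ a ∉ labels v := by simpa [labels] using ha
    obtain ⟨f, hf, s1⟩ := exists_sameKnot_swap (w := v ++ w) ha'.1 h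
    have hfv : v.flatMap f = v := flatMap_eq_self fun e he =>
      hf.over_eq e (hv e (by simp [he])) fun hm =>
        ha'.2 (List.mem_singleton.1 hm ▸ label_mem_labels he)
    rw [List.flatMap_append, hfv] at s1
    have s2 := sameKnot_rotate (u := [⟨b, true, z⟩]) (v := ⟨a, false, x⟩ :: (v ++ w.flatMap f))
      s1.2.1
    obtain ⟨g, hg, s3⟩ := ih (w := w.flatMap f ++ [⟨b, true, z⟩])
      (fun e he => hv e (by simp [he])) ha'.2 (by simpa using s2.2.1)
    have hgb : g ⟨b, true, z⟩ = [⟨b, true, z⟩] := hg.over_eq _ rfl (by simpa using ha'.1.symm)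
    have s4 := sameKnot_rotate (u := v ++ ⟨a, false, x⟩ :: (w.flatMap f).flatMap g)
      (v := [⟨b, true, z⟩]) (by simpa [hgb] using s3.2.1)
    refine ⟨_, hf.comp hg (A := [a]) (B := labels (⟨b, true, z⟩ :: v)) (by simp)
      (by simp [labels]) (by simp) (by simp [labels]), ?_⟩
    rw [← List.flatMap_assoc]
    simp only [List.flatMap_append, List.flatMap_cons, List.flatMap_nil, hgb, List.append_assoc,
      List.cons_append, List.nil_append, List.append_nil] at s1 s2 s3 s4 ⊢
    exact s1.trans (s2.trans (s3.trans s4))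

/-- A run of under-letters can be moved past the run of over-letters that follows it, if they have no
label in common. -/
theorem exists_sameKnot_move_run {u v w : List Letter} (hu : ∀ e ∈ u, e.isOver = false)
    (hv : ∀ e ∈ v, e.isOver = true) (huv : ∀ a ∈ labels u, a ∉ labels v)
    (h : IsGaussCode (u ++ v ++ w)) :
    ∃ f, Inflation (labels u) (labels v) f ∧ SameKnot (u ++ v ++ w)
      (v ++ u ++ w.flatMap f) := by
  induction u generalizing w with
  | nil => exact ⟨_, inflation_singleton _ _, by simpa using SameKnot.refl h⟩
  | cons e u ih =>
    obtain ⟨a, o, x⟩ := e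
    obtain rfl : o = false := hu ⟨a, o, x⟩ (by simp)
    have ha : a ∉ labels v := huv a (by simp [labels])
    have s1 := sameKnot_rotate (u := [⟨a, false, x⟩]) (v := u ++ v ++ w) h
    obtain ⟨f, hf, s2⟩ := ih (w := w ++ [⟨a, false, x⟩]) (fun e he => hu e (by simp [he]))
      (fun b hb => huv b (by simp only [labels, List.map_cons, List.mem_cons] at hb ⊢; tauto))
      (by simpa using s1.2.1)
    have hfa : f ⟨a, false, x⟩ = [⟨a, false, x⟩] := hf.under_eq _ rfl ha
    have s3 := sameKnot_rotate (u := v ++ u ++ w.flatMap f) (v := [⟨a, false, x⟩])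
      (by simpa [hfa] using s2.2.1)
    obtain ⟨g, hg, s4⟩ := exists_sameKnot_move_under (a := a) (x := x) (v := v)
      (w := u ++ w.flatMap f) hv ha (by simpa using s3.2.1)
    have hgu : u.flatMap g = u := flatMap_eq_self fun e he =>
      hg.under_eq e (hu e (by simp [he])) (huv _ (by
        simp only [labels, List.map_cons, List.mem_cons]
        exact .inr (label_mem_labels he)))
    refine ⟨_, hf.comp hg (A := labels (⟨a, false, x⟩ :: u)) (B := labels v) (by simp [labels])
      (by simp) (by simp [labels]) (by simp), ?_⟩
    rw [← List.flatMap_assoc]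
    simp only [List.flatMap_append, List.flatMap_cons, List.flatMap_nil, hfa, hgu,
      List.append_assoc, List.cons_append, List.nil_append, List.append_nil] at s1 s2 s3 s4 ⊢
    exact s1.trans (s2.trans (s3.trans s4))

theorem exists_sameKnot_move_run_in {p u v w : List Letter} (hu : ∀ e ∈ u, e.isOver = false)
    (hv : ∀ e ∈ v, e.isOver = true) (huv : ∀ a ∈ labels u, a ∉ labels v)
    (h : IsGaussCode (p ++ u ++ v ++ w)) :
    ∃ f, Inflation (labels u) (labels v) f ∧ SameKnot (p ++ u ++ v ++ w)
      (p.flatMap f ++ v ++ u ++ w.flatMap f) := by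
  have s1 := sameKnot_rotate (u := p) (v := u ++ v ++ w) (by simpa using h)
  obtain ⟨f, hf, s2⟩ := exists_sameKnot_move_run (w := w ++ p) hu hv huv
    (by simpa using s1.2.1)
  have s3 := sameKnot_rotate (u := v ++ u ++ w.flatMap f) (v := p.flatMap f)
    (by simpa using s2.2.1)
  refine ⟨f, hf, ?_⟩
  simp only [List.flatMap_append, List.append_assoc] at s1 s2 s3 ⊢
  exact s1.trans (s2.trans s3)

/-! ### A code of the sum with few overbridges -/

/-- In a Gauss code each crossing has only two letters; `v` contains both or neither. -/
theorem IsGaussCode.of_append {u v : List Letter} (h : IsGaussCode (u ++ v))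
    (hv : IsGaussCode v) : IsGaussCode u ∧ ∀ a ∈ labels u, a ∉ labels v := by
  have hn := h.1
  rw [List.map_append, List.nodup_append] at hn
  have hd : ∀ a ∈ labels u, a ∉ labels v := by
    intro a ha hav
    obtain ⟨e, he, rfl⟩ := List.mem_map.1 ha
    obtain ⟨f, hf, hfe⟩ := List.mem_map.1 hav
    obtain ⟨g, hg, hgf, hgo⟩ := hv.exists_isOver hf e.isOver
    exact hn.2.2 _ (List.mem_map_of_mem he) _ (List.mem_map_of_mem hg)
      (by rw [hgf, hgo, hfe])
  refine ⟨⟨hn.1, fun e he => ?_⟩, hd⟩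
  refine (List.mem_append.1 (h.2 e (List.mem_append_left _ he))).resolve_right fun hp => ?_
  exact hd _ (label_mem_labels he) (label_mem_labels (e := e.partner) hp)

/-- The number of overbridges of the long word `w` followed by an over-letter. -/
def openBridges (w : List Letter) : ℕ := ascents false w + if lastOver false w then 0 else 1

theorem ascents_of_over {v : List Letter} (hv : ∀ e ∈ v, e.isOver = true) (p : Bool) :
    ascents p v + (if lastOver p v then 0 else 1) = if p then 0 else 1 := by
  induction v generalizing p with
  | nil => exact Nat.zero_add _
  | cons e v ih =>
    have he := hv e (by simp)
    have := ih (fun e he => hv e (by simp [he])) true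
    simp only [ascents, lastOver, he, add_assoc, this]
    cases p <;> rfl

theorem ascents_of_under {u : List Letter} (hu : ∀ e ∈ u, e.isOver = false) (p : Bool) :
    ascents p u = 0 := by
  induction u generalizing p with
  | nil => rfl
  | cons e u ih => simp [ascents, hu e (by simp), ih fun e he => hu e (by simp [he])]

/-- `openBridges` already counts the bridge that a following over-letter would open. -/
theorem openBridges_append_over {u v : List Letter} (hv : ∀ e ∈ v, e.isOver = true) :
    openBridges (u ++ v) = openBridges u := by
  have := ascents_of_over hv (lastOver false u)
  rw [openBridges, openBridges, ascents_append, lastOver_append]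
  omega

theorem openBridges_append_under_le {u v : List Letter} (hv : ∀ e ∈ v, e.isOver = false) :
    openBridges (u ++ v) ≤ openBridges u + 1 := by
  rw [openBridges, openBridges, ascents_append, ascents_of_under hv]
  split_ifs <;> omega

theorem ascents_le_ascents_false (p : Bool) (w : List Letter) : ascents p w ≤ ascents false w := by
  cases w with
  | nil => rfl
  | cons e w => cases p <;> simp [ascents]

theorem overbridges_append_under_le {u v : List Letter} (hv : ∀ e ∈ v, e.isOver = false) :
    overbridges (u ++ v) ≤ openBridges u := by
  by_cases hw : u ++ v = []
  · obtain ⟨rfl, rfl⟩ := List.append_eq_nil_iff.1 hw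
    simp [overbridges, openBridges, ascents, lastOver]
  · rw [overbridges_eq_ascents hw false]
    refine (ascents_le_ascents_false _ _).trans ?_
    rw [ascents_append, ascents_of_under hv, openBridges]
    omega

/-- Bridges depend only on the alternation of heights, which is unchanged when letters become
nonempty runs of their own height. -/
theorem ascents_flatMap {f : Letter → List Letter} (h0 : ∀ e, f e ≠ [])
    (h : ∀ e, ∀ x ∈ f e, x.isOver = e.isOver) (p : Bool) (w : List Letter) :
    ascents p (w.flatMap f) = ascents p w ∧ lastOver p (w.flatMap f) = lastOver p w := by
  have key : ∀ (o p : Bool) (v : List Letter), v ≠ [] → (∀ x ∈ v, x.isOver = o) →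
      ascents p v = (if !p && o then 1 else 0) ∧ lastOver p v = o := by
    intro o p v hv hvo
    induction v generalizing p with
    | nil => exact absurd rfl hv
    | cons e v ih =>
      have he := hvo e (by simp)
      rcases eq_or_ne v [] with rfl | hv'
      · simp [ascents, lastOver, he]
      · obtain ⟨h1, h2⟩ := ih o hv' fun x hx => hvo x (by simp [hx])
        simp only [ascents, lastOver, he, h1, h2]
        cases o <;> simp
  induction w generalizing p with
  | nil => exact ⟨rfl, rfl⟩
  | cons e w ih =>
    obtain ⟨h1, h2⟩ := key e.isOver p (f e) (h0 e) (h e)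
    rw [List.flatMap_cons, ascents_append, lastOver_append, h1, h2, (ih _).1, (ih _).2]
    exact ⟨rfl, rfl⟩

theorem Inflation.openBridges_flatMap {A B : List ℕ} {f : Letter → List Letter}
    (hf : Inflation A B f) (w : List Letter) : openBridges (w.flatMap f) = openBridges w := by
  obtain ⟨h1, h2⟩ := ascents_flatMap hf.ne_nil hf.isOver_eq false w
  rw [openBridges, openBridges, h1, h2]

theorem Inflation.isOver_flatMap {A B : List ℕ} {f : Letter → List Letter}
    (hf : Inflation A B f) {w : List Letter} {o : Bool} (hw : ∀ e ∈ w, e.isOver = o) :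
    ∀ e ∈ w.flatMap f, e.isOver = o := by
  intro x hx
  obtain ⟨e, he, hx⟩ := List.mem_flatMap.1 hx
  rw [hf.isOver_eq e x hx, hw e he]

theorem Inflation.flatMap_eq {A B : List ℕ} {f : Letter → List Letter}
    (hf : Inflation A B f) {w : List Letter} (hA : ∀ a ∈ labels w, a ∉ A)
    (hB : ∀ a ∈ labels w, a ∉ B) : w.flatMap f = w := by
  refine flatMap_eq_self fun e he => ?_
  rcases ho : e.isOver with _ | _
  · exact hf.under_eq e ho (hB _ (label_mem_labels he))
  · exact hf.over_eq e ho (hA _ (label_mem_labels he))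

/-- A long word that ends with a run of under-letters absorbs the beginning of the next word. -/
theorem SameKnot.absorb {w A U p u v x y z r : List Letter}
    (h : SameKnot w (A ++ U ++ (p ++ u ++ v ++ x ++ y ++ z ++ r)))
    (hAU : IsGaussCode (A ++ U)) (hb : IsGaussCode (p ++ u ++ v ++ x ++ y ++ z))
    (hU : ∀ e ∈ U, e.isOver = false) (hp : ∀ e ∈ p, e.isOver = true)
    (hu : ∀ e ∈ u, e.isOver = false) (hv : ∀ e ∈ v, e.isOver = true)
    (huv : ∀ a ∈ labels u, a ∉ labels v) (hx : ∀ e ∈ x, e.isOver = false) :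
    ∃ (A' U' : List Letter) (F : Letter → List Letter), (∀ e ∈ U', e.isOver = false) ∧
      openBridges A' = openBridges A ∧ (∀ e, ∀ x ∈ F e, x.isOver = e.isOver) ∧ IsGaussCode r ∧
      SameKnot w (A' ++ U' ++ y.flatMap F ++ z.flatMap F ++ r) := by
  have h1 := (isGaussCode_perm List.perm_append_comm).1 h.2.1
  obtain ⟨hbr, hd1⟩ := h1.of_append hAU
  obtain ⟨hr, hd2⟩ := ((isGaussCode_perm List.perm_append_comm).1 hbr).of_append hb
  -- Inside the block, `p u v x` becomes `p v u x`. The labels of `A ++ U` and `r` are disjoint from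
  -- the block, so those parts do not change.
  obtain ⟨f, hf, s1⟩ := exists_sameKnot_move_run_in (p := A ++ U ++ p) (w := x ++ y ++ z ++ r)
    hu hv huv (by simpa using h.2.1)
  have fAU : (A ++ U).flatMap f = A ++ U :=
    hf.flatMap_eq (fun a ha ha' => hd1 a (by simp [labels_append, ha']) ha)
      (fun a ha ha' => hd1 a (by simp [labels_append, ha']) ha)
  have fr : r.flatMap f = r :=
    hf.flatMap_eq (fun a ha ha' => hd2 a ha (by simp [labels_append, ha']))
      (fun a ha ha' => hd2 a ha (by simp [labels_append, ha']))
  have e1 : (A ++ U ++ p).flatMap f ++ v ++ u ++ (x ++ y ++ z ++ r).flatMap f =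
      (A ++ U) ++ (p.flatMap f ++ v ++ (u ++ x.flatMap f ++ y.flatMap f ++ z.flatMap f) ++ r) := by
    rw [List.flatMap_append, fAU]
    simp only [List.flatMap_append, fr, List.append_assoc]
  rw [e1] at s1
  obtain ⟨h2, hd3⟩ := ((isGaussCode_perm List.perm_append_comm).1 s1.2.1).of_append hAU
  obtain ⟨-, hd4⟩ := h2.of_append hr
  have hpv : ∀ e ∈ p.flatMap f ++ v, e.isOver = true := by
    intro e he
    rcases List.mem_append.1 he with he | he
    · exact hf.isOver_flatMap hp e he
    · exact hv e he
  -- Now `U` moves past `p v`: the overs join `A`, and the unders `U u x` form a single run. Again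
  -- `r` stays intact, ready for the next summand.
  obtain ⟨g, hg, s2⟩ := exists_sameKnot_move_run_in (p := A) (u := U) (v := p.flatMap f ++ v)
    (w := u ++ x.flatMap f ++ y.flatMap f ++ z.flatMap f ++ r) hU hpv
    (fun a ha ha' => hd3 a (by rw [labels_append, labels_append]; exact .inl (.inl ha'))
      (by simp [labels_append, ha])) (by simpa using s1.2.1)
  have gr : r.flatMap g = r :=
    hg.flatMap_eq (fun a ha ha' => hd1 a (by simp [labels_append, ha])
      (by simp [labels_append, ha']))
      (fun a ha ha' => hd4 a (by rw [labels_append]; exact .inl ha') ha)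
  refine ⟨A.flatMap g ++ (p.flatMap f ++ v), U ++ (u ++ x.flatMap f).flatMap g,
    fun e => (f e).flatMap g, ?_, ?_, fun e a ha => ?_, hr, ?_⟩
  · intro e he
    rcases List.mem_append.1 he with he | he
    · exact hU e he
    · refine hg.isOver_flatMap (fun e he => ?_) e he
      rcases List.mem_append.1 he with he | he
      · exact hu e he
      · exact hf.isOver_flatMap hx e he
  · rw [openBridges_append_over hpv, hg.openBridges_flatMap]
  · obtain ⟨b, hb, ha⟩ := List.mem_flatMap.1 ha
    rw [hg.isOver_eq b a ha, hf.isOver_eq e b hb]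
  · rw [← List.flatMap_assoc, ← List.flatMap_assoc]
    simp only [List.flatMap_append, gr, List.append_assoc] at h s1 s2 ⊢
    exact h.trans (s1.trans s2)

/-- The long word `b` can be absorbed at the cost of `c` overbridges. -/
def Absorbs (b : List Letter) (c : ℕ) : Prop :=
  ∀ w A U r : List Letter, (∀ e ∈ U, e.isOver = false) → IsGaussCode (A ++ U) →
    SameKnot w (A ++ U ++ (b ++ r)) → ∃ A' U' : List Letter, (∀ e ∈ U', e.isOver = false) ∧
      IsGaussCode (A' ++ U') ∧ openBridges A' ≤ openBridges A + c ∧ SameKnot w (A' ++ U' ++ r)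

theorem Absorbs.append {b b' : List Letter} {c c' : ℕ} (h : Absorbs b c) (h' : Absorbs b' c') :
    Absorbs (b ++ b') (c + c') := by
  intro w A U r hU hAU hw
  rw [List.append_assoc b] at hw
  obtain ⟨A₁, U₁, hU₁, hAU₁, hle, hw⟩ := h w A U _ hU hAU hw
  obtain ⟨A₂, U₂, hU₂, hAU₂, hle', hw⟩ := h' w A₁ U₁ r hU₁ hAU₁ hw
  exact ⟨A₂, U₂, hU₂, hAU₂, by omega, hw⟩

theorem absorbs_flatMap {g : ℕ → List Letter} {c : ℕ} (h : ∀ i, Absorbs (g i) c) (n : ℕ) :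
    Absorbs ((List.range n).flatMap g) (n * c) := by
  induction n with
  | zero => exact fun w A U r hU hAU hw => ⟨A, U, hU, hAU, by omega, by simpa using hw⟩
  | succ n ih =>
    rw [flatMap_range_succ, Nat.succ_mul]
    exact ih.append (h n)

theorem absorbs_bowTie (k : ℕ) : Absorbs (shift k bowTie) 0 := by
  intro w A U r hU hAU hw
  have hb := isGaussCode_shift k isGaussCode_bowTie
  set e : ℕ → Bool → Bool → Letter := fun l o s => ⟨l + k, o, s⟩ with he
  -- `U0` shares no label with `O2 O3`, so the whole bow-tie is absorbed and nothing is left over.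
  have hbow : shift k bowTie = [e 0 true false, e 1 true true] ++ [e 0 false false] ++
      [e 2 true true, e 3 true true] ++ [e 2 false true, e 3 false true, e 1 false true] ++
      [] ++ [] := rfl
  rw [hbow] at hw hb
  obtain ⟨A', U', F, h1, h2, -, hr, h4⟩ := hw.absorb hAU hb hU (by simp [he]) (by simp [he])
    (by simp [he]) (by simp [he, labels]) (by simp [he])
  have h4 : SameKnot w (A' ++ U' ++ r) := by simpa using h4
  exact ⟨A', U', h1, (h4.2.1.of_append hr).1, h2.le, h4⟩

theorem absorbs_trefoil (k : ℕ) : Absorbs (shift k trefoil) 1 := by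
  intro w A U r hU hAU hw
  have hb := isGaussCode_shift k isGaussCode_trefoil
  set e : ℕ → Bool → Letter := fun l o => ⟨l + k, o, true⟩ with he
  -- `O1` cannot be moved to the front in this way, since `U1` precedes it. It remains and accounts
  -- for the one additional bridge.
  have htre : shift k trefoil = [e 0 true] ++ [e 1 false] ++ [e 2 true] ++ [e 0 false] ++
      [e 1 true] ++ [e 2 false] := rfl
  rw [htre] at hw hb
  obtain ⟨A', U', F, h1, h2, hF, hr, h4⟩ := hw.absorb hAU hb hU (by simp [he]) (by simp [he])
    (by simp [he]) (by simp [he, labels]) (by simp [he])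
  simp only [List.flatMap_singleton] at h4
  refine ⟨A' ++ U' ++ F (e 1 true), F (e 2 false), fun x hx => hF _ x hx, ?_, ?_, h4⟩
  · exact (h4.2.1.of_append hr).1
  · rw [openBridges_append_over fun x hx => hF _ x hx, ← h2]
    exact openBridges_append_under_le h1

theorem exists_overbridges_le (n r : ℕ) :
    ∃ w, SameKnot (sumCode n r) w ∧ overbridges w ≤ r + 1 := by
  have h : Absorbs (sumCode n r) (n * 0 + r * 1) :=
    (absorbs_flatMap (fun i => absorbs_bowTie (4 * i)) n).append
      (absorbs_flatMap (fun j => absorbs_trefoil (4 * n + 3 * j)) r)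
  -- The empty word has `openBridges` equal to 1, which is the summand 1 in `r + 1`.
  obtain ⟨A, U, hU, -, hle, hw⟩ := h (sumCode n r) [] [] [] (by simp) (by simp [IsGaussCode])
    (by simpa using SameKnot.refl (isGaussCode_sumCode n r))
  rw [List.append_nil] at hw
  refine ⟨A ++ U, hw, (overbridges_append_under_le hU).trans (hle.trans ?_)⟩
  simp [openBridges, ascents, lastOver]
  omega

/-! ### The bridge numbers of the sum -/

/-- The sum of `n` bow-ties and `r` trefoils. -/
def sumKnot (n r : ℕ) : VirtualKnot := Quot.mk _ ⟨sumCode n r, isGaussCode_sumCode n r⟩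

theorem isRepresentedBy_sumKnot (n r : ℕ) : (sumKnot n r).IsRepresentedBy (sumCode n r) :=
  ⟨isGaussCode_sumCode n r, rfl⟩

theorem firstBridgeNumber_sumKnot (n r : ℕ) : (sumKnot n r).firstBridgeNumber = r + 1 := by
  obtain ⟨w, ⟨h, h', hw⟩, hle⟩ := exists_overbridges_le n r
  have hmem : overbridges w ∈ {k | ∃ w, (sumKnot n r).IsRepresentedBy w ∧ overbridges w = k} :=
    ⟨w, ⟨h', hw⟩, rfl⟩
  refine le_antisymm ((Nat.sInf_le hmem).trans hle) (le_csInf ⟨_, hmem⟩ ?_)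
  rintro _ ⟨w, hw, rfl⟩
  exact le_overbridges_of_isRepresentedBy (isRepresentedBy_sumKnot n r) hw

theorem tendsto_sub_nhds_top {b : ℕ → ℕ∞} (h : ∀ n : ℕ, (n : ℕ∞) ≤ b n + 1) (m : ℕ) :
    Tendsto (fun n => b n - (m : ℕ∞)) atTop (𝓝 ⊤) := by
  rw [ENat.tendsto_nhds_top_iff_natCast_lt]
  intro k
  filter_upwards [eventually_gt_atTop (k + m + 1)] with n hn
  rw [lt_tsub_iff_right]
  have h1 : ((k + m + 1 : ℕ) : ℕ∞) < n := by exact_mod_cast hn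
  have h2 := h1.trans_le (h n)
  push_cast at h2
  exact lt_of_add_lt_add_right h2

end VirtualBridge

theorem mainTheorem2 :
    ∃ K : ℕ → ℕ → VirtualBridge.VirtualKnot, ∀ m : ℕ, 1 ≤ m →
      (∀ n : ℕ, (K m n).IsRepresentedBy (VirtualBridge.sumCode n (m - 1))) ∧
      (∀ n : ℕ, (K m n).firstBridgeNumber = m) ∧
      Tendsto (fun n : ℕ => (K m n).secondBridgeNumber - ((K m n).firstBridgeNumber : ℕ∞))
        atTop (𝓝 ⊤) := by
  refine ⟨fun m n => VirtualBridge.sumKnot n (m - 1), fun m hm => ?_⟩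
  have h : ∀ n, (VirtualBridge.sumKnot n (m - 1)).firstBridgeNumber = m := fun n => by
    rw [VirtualBridge.firstBridgeNumber_sumKnot]
    omega
  refine ⟨fun n => VirtualBridge.isRepresentedBy_sumKnot n (m - 1), h, ?_⟩
  simp only [h]
  exact VirtualBridge.tendsto_sub_nhds_top (fun n =>
    VirtualBridge.le_secondBridgeNumber_add_one (VirtualBridge.isRepresentedBy_sumKnot n _)) m
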